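/- For $\rho>-1$ and $x,\beta\in\mathbb R$ let $W(x;\rho;\beta)=\sum_{k\ge 0}\frac{x^k}{k!\,\Gamma(\rho k+\beta)}$ be the Wright function (with $1/\Gamma=0$ at the poles of $\Gamma$), let $M_\rho(x)=W(-x;-\rho;1-\rho)$ for $0<\rho<1$, and let $\operatorname{erf}(x)=\frac{2}{\sqrt\pi}\int_0^x e^{-z^2}\,dz$. (a) The equation $x\operatorname{erf}(x)=e^{-x^2}/\sqrt\pi$ has a unique solution $\eta_1>0$. For every $\alpha\in(0,1)$ the equation $$2x\left[1-W\left(-2x;-\tfrac{\alpha}{2};1\right)\right]=M_{\alpha/2}(2x)\,\frac{\Gamma(1-\alpha/2)}{\Gamma(1+\alpha/2)}$$ has a unique solution $x=\eta_\alpha>0$, and the equation $$2x\left[1-W\left(-2x;-\tfrac{\alpha}{2};1\right)\right]=2x\,W\left(-2x;-\tfrac{\alpha}{2};1\right)+W\left(-2x;-\tfrac{\alpha}{2};1+\tfrac{\alpha}{2}\right)$$ has a unique solution $x=\xi_\alpha>0$. (b) For every $T>0$, the pair $w(x,t)=1-\frac{\operatorname{erf}(x/(2\sqrt t))}{\operatorname{erf}(\eta_1)}$,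 $s(t)=2\eta_1\sqrt t$ is the unique bounded classical solution of the one-phase Stefan problem $$u_t=u_{xx}\ (0<x<s(t),\ 0<t<T),\quad u(0,t)=1,\quad u(s(t),t)=0,\quad s'(t)=-u_x(s(t),t)\ (0<t\le T),\quad s(0)=0.$$ Here a bounded classical solution is a pair $(u,s)$ such that $s$ is continuous on $[0,T]$ and positive on $(0,T]$, $u$ is bounded and continuous on $\{0\le x\le s(t),\ 0<t\le T\}$, the derivatives $u_t,u_x,u_{xx}$ exist for $0<x<s(t)$, $0<t<T$, the derivatives $s'(t)$ and $u_x(s(t),t)$ exist for $0<t\le T$ (one-sided at $t=T$ and at $x=s(t)$), and all the above equations hold. Uniqueness means that any two such solutions have the same $s$ on $[0,T]$ and the same $u$ on $\{0\le x\le s(t),\ 0<t\le T\}$. (c) For $c>0$ put $$U_{\alpha,c}(x,t)=1-\frac{1-W\left(-x\,t^{-\alpha/2};-\frac{\alpha}{2};1\right)}{1-W\left(-2c;-\frac{\alpha}{2};1\right)},\qquad S_{\alpha,c}(t)=2c\,t^{\alpha/2}.$$ The pairs $(w_\alpha,r_\alpha)=(U_{\alpha,\eta_\alpha},S_{\alpha,\eta_\alpha})$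 and $(u_\alpha,s_\alpha)=(U_{\alpha,\xi_\alpha},S_{\alpha,\xi_\alpha})$ are the explicit solutions of the fractional Stefan problems of order $\alpha$ with Caputo and with Riemann–Liouville derivatives, respectively. As $\alpha\nearrow1$, one has $\eta_\alpha\to\eta_1$ and $\xi_\alpha\to\eta_1$; moreover $w_\alpha(x,t)\to w(x,t)$ and $u_\alpha(x,t)\to w(x,t)$ for all $x\ge0$, $t>0$, and $r_\alpha(t)\to s(t)$ and $s_\alpha(t)\to s(t)$ for all $t\ge0$. -/

import Mathlib

open Set Filter Topology

noncomputable section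

namespace Stefan

/-- The Wright function `W(x; ρ; β) = ∑ x ^ k / (k! Γ(ρ k + β))`. At the poles of `Γ` the
coefficient `1 / Γ` is `0`, which agrees with `Real.Gamma (-n) = 0` and `a / 0 = 0`. -/
def wright (x ρ β : ℝ) : ℝ :=
  ∑' k : ℕ, x ^ k / ((k.factorial : ℝ) * Real.Gamma (ρ * (k : ℝ) + β))

/-- The Mainardi function `M_ρ(x) = W(-x; -ρ; 1 - ρ)`. -/
def mainardi (ρ x : ℝ) : ℝ := wright (-x) (-ρ) (1 - ρ)

/-- The error function. -/
def erf (x : ℝ) : ℝ := 2 / Real.sqrt Real.pi * ∫ z in (0 : ℝ)..x, Real.exp (-z ^ 2)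

/-- The equation for the parameter of the explicit solution of the fractional Stefan problem with
Caputo derivatives. -/
def CaputoEq (α x : ℝ) : Prop :=
  2 * x * (1 - wright (-(2 * x)) (-(α / 2)) 1) =
    mainardi (α / 2) (2 * x) * (Real.Gamma (1 - α / 2) / Real.Gamma (1 + α / 2))

/-- The equation for the parameter of the explicit solution of the fractional Stefan problem with
Riemann–Liouville derivatives. -/
def RiemannLiouvilleEq (α x : ℝ) : Prop :=
  2 * x * (1 - wright (-(2 * x)) (-(α / 2)) 1) =
    2 * x * wright (-(2 * x)) (-(α / 2)) 1 + wright (-(2 * x)) (-(α / 2)) (1 + α / 2)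

/-- The equation for the parameter of the classical similarity solution. -/
def ClassicalEq (x : ℝ) : Prop :=
  x * erf x = Real.exp (-x ^ 2) / Real.sqrt Real.pi

/-- `c` is the one and only positive real number with property `P`. -/
def IsUniquePosRoot (P : ℝ → Prop) (c : ℝ) : Prop :=
  0 < c ∧ P c ∧ ∀ y : ℝ, 0 < y → P y → y = c

/-- The temperature of the explicit fractional solution of order `α` with parameter `c`. -/
def fracTemp (α c x t : ℝ) : ℝ :=
  1 - 1 / (1 - wright (-(2 * c)) (-(α / 2)) 1) *
    (1 - wright (-(x / t ^ (α / 2))) (-(α / 2)) 1)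

/-- The free boundary of the explicit fractional solution of order `α` with parameter `c`. -/
def fracFront (α c t : ℝ) : ℝ := 2 * c * t ^ (α / 2)

/-- The temperature of the classical similarity solution with parameter `c`. -/
def classicalTemp (c x t : ℝ) : ℝ := 1 - 1 / erf c * erf (x / (2 * Real.sqrt t))

/-- The free boundary of the classical similarity solution with parameter `c`. -/
def classicalFront (c t : ℝ) : ℝ := 2 * c * Real.sqrt t

/-- `(u, s)` is a (bounded) classical solution on the time interval `(0, T]` of the one-phase
Stefan problem `u_t = u_xx` for `0 < x < s(t)`, `u(0, t) = 1`, `u(s(t), t) = 0`, `s(0) = 0`,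
`s'(t) = -u_x(s(t), t)`. The boundary data are discontinuous at the corner `(0, 0)`, so that
continuity is required up to the boundary for `t > 0`, and boundedness near the corner. Derivatives
at boundary points are one-sided; only values of `u` on `0 ≤ x ≤ s(t)`, `0 < t ≤ T` matter. -/
structure IsClassicalSolution (T : ℝ) (u : ℝ → ℝ → ℝ) (s : ℝ → ℝ) : Prop where
  front_zero : s 0 = 0
  front_pos : ∀ t ∈ Ioc 0 T, 0 < s t
  front_continuous : ContinuousOn s (Icc 0 T)
  temp_continuous :
    ContinuousOn (fun p : ℝ × ℝ => u p.1 p.2) {p | p.2 ∈ Ioc 0 T ∧ p.1 ∈ Icc 0 (s p.2)}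
  temp_bounded : ∃ C : ℝ, ∀ t ∈ Ioc 0 T, ∀ x ∈ Icc 0 (s t), |u x t| ≤ C
  diff_t : ∀ t ∈ Ioo 0 T, ∀ x ∈ Ioo 0 (s t), DifferentiableAt ℝ (fun τ => u x τ) t
  diff_x : ∀ t ∈ Ioo 0 T, ∀ x ∈ Ioo 0 (s t), DifferentiableAt ℝ (fun y => u y t) x
  diff_xx : ∀ t ∈ Ioo 0 T, ∀ x ∈ Ioo 0 (s t), DifferentiableAt ℝ (deriv fun y => u y t) x
  heat : ∀ t ∈ Ioo 0 T, ∀ x ∈ Ioo 0 (s t),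
    deriv (fun τ => u x τ) t = deriv (deriv fun y => u y t) x
  fixed_face : ∀ t ∈ Ioc 0 T, u 0 t = 1
  front_temp : ∀ t ∈ Ioc 0 T, u (s t) t = 0
  diff_front : ∀ t ∈ Ioc 0 T,
    DifferentiableWithinAt ℝ (fun x => u x t) (Icc 0 (s t)) (s t)
  stefan : ∀ t ∈ Ioc 0 T,
    HasDerivWithinAt s (-derivWithin (fun x => u x t) (Icc 0 (s t)) (s t)) (Icc 0 T) t

end Stefan

end

/-!
The Wright function `W(-z; -a; β)` with `0 < a ≤ 1 / 2` has derivative `-W(-z; -a; β - a)` in `z`.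
Everything about the transcendental equations follows from its nonnegativity for `z, β ≥ 0`
(`wright_nonneg`). That holds because `(1 - ε (1 - X) ^ a) ^ n (1 - X) ^ (-β)` has nonnegative
coefficients for `0 ≤ ε ≤ 1`: all coefficients of `(1 - X) ^ a` other than the constant one are
nonpositive, and those of `(1 - X) ^ (-β)` are nonnegative. By the binomial theorem and
Gauss' product for `1 / Γ`, a suitable coefficient converges to `W(-z; -a; β)` as `n → ∞`, with the
explicit majorant `gammaInvBound` allowing dominated convergence in the series. The same majorant gives
joint continuity in `(z, a, β)` up to `a = 1 / 2`.

Hence `W(-z; -a; 1)` and the Mainardi function `W(-z; -a; 1 - a)` decrease, and the differences of the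
two sides of both equations are strictly increasing, negative at `0` and eventually nonnegative. For
`a = 1 / 2` the Wright functions reduce to the error function and Gaussians, and both equations become
`x erf x = exp (-x ^ 2) / √π`. Pointwise convergence of strictly increasing functions makes their roots
converge (`tendsto_of_isUniquePosRoot`), and joint continuity gives convergence of the solutions.

Uniqueness in the Stefan problem rests on the weak maximum principle and on first contact arguments,
since nothing is known about `u_x` near the boundary besides its existence on the front. A Gaussian
barrier removes the corner `(0, 0)`, where `u` is only bounded (`caloric_le_of_lateral_boundary`).
A given front `s` is then compared with the fronts `2 c √(t + δ)` for `c > η₁` and `2 c √(t - δ)` for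
`c < η₁`, each carrying the similarity temperature multiplied by a constant `lam` larger, resp. smaller,
than `1`. The sign of `c erf c - exp (-c ^ 2) / √π` leaves room to choose `lam` such that these are
strict super- and subsolutions of the Stefan condition, so no boundary point lemma is needed. Letting
`c → η₁` and `δ → 0` gives `s = 2 η₁ √t`, and the temperatures agree by the maximum principle.
-/

namespace Stefan

/-! ### The reciprocal Gamma function -/

/-- With `g = |s|`, a common bound for `1 / Γ(s)` and the Gauss products `1 / GammaSeq s n`, `n ≠ 0`,
converging to it. -/
noncomputable def gammaInvBound (g : ℝ) : ℝ := g * (Real.exp g * (g + 1) ^ g)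

theorem gammaInvBound_mono {g h : ℝ} (hg : 0 ≤ g) (hgh : g ≤ h) :
    gammaInvBound g ≤ gammaInvBound h := by
  unfold gammaInvBound
  have h1 : (g + 1) ^ g ≤ (h + 1) ^ h :=
    (Real.rpow_le_rpow (by linarith) (by linarith) hg).trans
      (Real.rpow_le_rpow_of_exponent_le (by linarith) hgh)
  gcongr
  exact hg.trans hgh

theorem gammaSeq_inv (s : ℝ) (n : ℕ) :
    (Real.GammaSeq s n)⁻¹ =
      (∏ j ∈ Finset.range (n + 1), (s + j)) / ((n : ℝ) ^ s * (n.factorial : ℝ)) := by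
  rw [Real.GammaSeq, inv_div]

/-- The part `∏ |1 - g / j|` of the Gauss product for `1 / Γ(-g)` decays like `n ^ (-g)`. As long as
`n ≤ g` the factors are at most `g / j`; afterwards they are at most `exp (-g / j)`. -/
theorem prod_abs_sub_le {g : ℝ} (hg : 0 ≤ g) (n : ℕ) :
    (∏ j ∈ Finset.range n, |(j : ℝ) + 1 - g|) / n.factorial * ((n : ℝ) + 1) ^ g ≤
      Real.exp g * (g + 1) ^ g := by
  induction n with
  | zero =>
    simp only [Finset.range_zero, Finset.prod_empty, Nat.factorial_zero, Nat.cast_one, div_one,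
      Nat.cast_zero, zero_add, Real.one_rpow, mul_one]
    exact (Real.one_le_exp hg).trans (le_mul_of_one_le_right (Real.exp_pos g).le
      (Real.one_le_rpow (by linarith) hg))
  | succ n ih =>
    rcases le_or_gt (((n + 1 : ℕ) : ℝ)) g with h | h
    · have h1 : (∏ j ∈ Finset.range (n + 1), |(j : ℝ) + 1 - g|) ≤ g ^ (n + 1) := by
        refine (Finset.prod_le_prod (fun j _ => abs_nonneg _) (fun j hj => ?_)).trans_eq
          ((Finset.prod_const g).trans (by rw [Finset.card_range]))
        have hj' : (j : ℝ) + 1 ≤ ((n + 1 : ℕ) : ℝ) := by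
          have := Finset.mem_range.1 hj
          exact_mod_cast this
        rw [abs_le]; constructor <;> linarith [(Nat.cast_nonneg j : (0 : ℝ) ≤ j)]
      have h2 := Real.pow_div_factorial_le_exp g hg (n + 1)
      have h3 : (((n + 1 : ℕ) : ℝ) + 1) ^ g ≤ (g + 1) ^ g :=
        Real.rpow_le_rpow (by positivity) (by linarith) hg
      refine mul_le_mul (le_trans ?_ h2) h3 (by positivity) (by positivity)
      gcongr
    · refine le_trans ?_ ih
      rw [Finset.prod_range_succ, Nat.factorial_succ]
      have hn : (0 : ℝ) < n + 1 := by positivity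
      have habs : |(n : ℝ) + 1 - g| = n + 1 - g := abs_of_pos (by push_cast at h; linarith)
      rw [habs]
      -- the new factor `(1 - g / (n + 1)) ((n + 2) / (n + 1)) ^ g` is at most `1`
      have key : ((n : ℝ) + 1 - g) / (n + 1) * (((n + 1 : ℕ) : ℝ) + 1) ^ g ≤ ((n : ℝ) + 1) ^ g := by
        have e1 : ((n : ℝ) + 1 - g) / (n + 1) ≤ Real.exp (-(g / (n + 1))) := by
          have := Real.add_one_le_exp (-(g / ((n : ℝ) + 1)))
          have e : ((n : ℝ) + 1 - g) / (n + 1) = -(g / ((n : ℝ) + 1)) + 1 := by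
            field_simp; ring
          rw [e]; exact this
        have e2 : (((n + 1 : ℕ) : ℝ) + 1) ≤ ((n : ℝ) + 1) * Real.exp (1 / (n + 1)) := by
          have := Real.add_one_le_exp (1 / ((n : ℝ) + 1))
          calc (((n + 1 : ℕ) : ℝ) + 1) = ((n : ℝ) + 1) * (1 / ((n : ℝ) + 1) + 1) := by
                push_cast; field_simp; ring
            _ ≤ _ := by gcongr
        calc ((n : ℝ) + 1 - g) / (n + 1) * (((n + 1 : ℕ) : ℝ) + 1) ^ g
            ≤ Real.exp (-(g / (n + 1))) * (((n : ℝ) + 1) * Real.exp (1 / (n + 1))) ^ g := by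
              gcongr
          _ = ((n : ℝ) + 1) ^ g := by
              rw [Real.mul_rpow hn.le (Real.exp_pos _).le, ← Real.exp_mul, mul_left_comm,
                ← Real.exp_add]
              have : -(g / ((n : ℝ) + 1)) + 1 / ((n : ℝ) + 1) * g = 0 := by ring
              rw [this]; simp
      have hP : 0 ≤ (∏ j ∈ Finset.range n, |(j : ℝ) + 1 - g|) / n.factorial := by positivity
      calc (∏ x ∈ Finset.range n, |(x : ℝ) + 1 - g|) * ((n : ℝ) + 1 - g) /
              ((n + 1) * n.factorial : ℕ) * (((n + 1 : ℕ) : ℝ) + 1) ^ g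
          = (∏ j ∈ Finset.range n, |(j : ℝ) + 1 - g|) / n.factorial *
            (((n : ℝ) + 1 - g) / (n + 1) * (((n + 1 : ℕ) : ℝ) + 1) ^ g) := by
            push_cast; field_simp
        _ ≤ _ := mul_le_mul_of_nonneg_left key hP

theorem prod_add_le {g : ℝ} (hg : 0 ≤ g) {n : ℕ} (hn : n ≠ 0) :
    (∏ j ∈ Finset.range n, ((j : ℝ) + 1 + g)) / n.factorial ≤ Real.exp g * (n : ℝ) ^ g := by
  have h1 : (∏ j ∈ Finset.range n, ((j : ℝ) + 1 + g)) / n.factorial ≤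
      Real.exp (g * (harmonic n : ℝ)) := by
    rw [← Finset.prod_range_add_one_eq_factorial, harmonic]
    push_cast
    rw [← Finset.prod_div_distrib, Finset.mul_sum, Real.exp_sum]
    refine Finset.prod_le_prod (fun j _ => by positivity) (fun j _ => ?_)
    have := Real.add_one_le_exp (g * ((j : ℝ) + 1)⁻¹)
    have e : ((j : ℝ) + 1 + g) / (j + 1) = g * ((j : ℝ) + 1)⁻¹ + 1 := by field_simp; ring
    rw [e]; exact this
  refine h1.trans ?_
  have h2 := harmonic_le_one_add_log n
  have hn' : (0 : ℝ) < n := by positivity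
  rw [Real.rpow_def_of_pos hn', ← Real.exp_add]
  apply Real.exp_le_exp.2
  nlinarith

theorem abs_gammaSeq_inv_le (s : ℝ) {n : ℕ} (hn : n ≠ 0) :
    |(Real.GammaSeq s n)⁻¹| ≤ gammaInvBound |s| := by
  have hn' : (0 : ℝ) < n := by positivity
  rw [gammaSeq_inv, abs_div, Finset.prod_range_succ', abs_mul, Finset.abs_prod,
    abs_of_pos (by positivity : 0 < (n : ℝ) ^ s * (n.factorial : ℝ)), gammaInvBound]
  have hfac : (0 : ℝ) < n.factorial := by positivity
  rw [show ((∏ j ∈ Finset.range n, |s + ((j + 1 : ℕ) : ℝ)|) * |s + ((0 : ℕ) : ℝ)|) /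
      ((n : ℝ) ^ s * (n.factorial : ℝ)) = |s| *
      ((∏ j ∈ Finset.range n, |s + ((j + 1 : ℕ) : ℝ)|) / n.factorial * (n : ℝ) ^ (-s)) by
    rw [Real.rpow_neg hn'.le]; simp only [Nat.cast_zero, add_zero]; field_simp]
  refine mul_le_mul_of_nonneg_left ?_ (abs_nonneg s)
  rcases le_or_gt 0 s with hs | hs
  · rw [abs_of_nonneg hs]
    have h1 := prod_add_le hs hn
    have h2 : ∏ j ∈ Finset.range n, |s + ((j + 1 : ℕ) : ℝ)| =
        ∏ j ∈ Finset.range n, ((j : ℝ) + 1 + s) :=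
      Finset.prod_congr rfl fun j _ => by
        rw [abs_of_nonneg (by positivity)]; push_cast; ring
    rw [h2]
    calc _ ≤ Real.exp s * (n : ℝ) ^ s * (n : ℝ) ^ (-s) := by gcongr
      _ = Real.exp s := by rw [mul_assoc, ← Real.rpow_add hn']; simp
      _ ≤ _ := le_mul_of_one_le_right (by positivity) (Real.one_le_rpow (by linarith) hs)
  · rw [abs_of_neg hs]
    have h1 := prod_abs_sub_le (neg_nonneg.2 hs.le) n
    have h2 : ∏ j ∈ Finset.range n, |s + ((j + 1 : ℕ) : ℝ)| =
        ∏ j ∈ Finset.range n, |(j : ℝ) + 1 - -s| :=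
      Finset.prod_congr rfl fun j _ => by congr 1; push_cast; ring
    rw [h2]
    refine le_trans ?_ h1
    gcongr
    · linarith
    · linarith

/-- Gauss' product for `1 / Γ`, including the poles of `Γ`, where `Real.Gamma s = 0` and
`(Real.Gamma s)⁻¹ = 0`. -/
theorem tendsto_gammaSeq_inv (s : ℝ) :
    Tendsto (fun n => (Real.GammaSeq s n)⁻¹) atTop (𝓝 (Real.Gamma s)⁻¹) := by
  by_cases h : Real.Gamma s = 0
  · rw [h, inv_zero]
    obtain ⟨m, hm⟩ := (Real.Gamma_eq_zero_iff s).1 h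
    refine tendsto_const_nhds.congr' ?_
    filter_upwards [eventually_ge_atTop m] with n hn
    rw [gammaSeq_inv, Finset.prod_eq_zero (Finset.mem_range.2 (Nat.lt_succ_of_le hn)), zero_div]
    rw [hm]; ring
  · exact (Real.GammaSeq_tendsto_Gamma s).inv₀ h

theorem abs_gamma_inv_le (s : ℝ) : |(Real.Gamma s)⁻¹| ≤ gammaInvBound |s| := by
  refine le_of_tendsto (tendsto_gammaSeq_inv s).abs ?_
  filter_upwards [eventually_ne_atTop 0] with n hn using abs_gammaSeq_inv_le s hn

theorem continuous_gamma_inv : Continuous fun s : ℝ => (Real.Gamma s)⁻¹ := by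
  have h := Complex.continuous_re.comp
    (Complex.differentiable_one_div_Gamma.continuous.comp Complex.continuous_ofReal)
  refine h.congr fun s => ?_
  simp only [Function.comp_apply, Complex.Gamma_ofReal]
  rw [← Complex.ofReal_inv, Complex.ofReal_re]

theorem summable_pow_div_sqrt_factorial {D : ℝ} (hD : 0 < D) :
    Summable fun k : ℕ => D ^ k / Real.sqrt k.factorial := by
  refine summable_of_ratio_test_tendsto_lt_one (l := 0) zero_lt_one
    (Eventually.of_forall fun k => by positivity) ?_
  have h : Tendsto (fun k : ℕ => D / Real.sqrt ((k : ℝ) + 1)) atTop (𝓝 0) :=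
    Tendsto.div_atTop tendsto_const_nhds
      (Real.tendsto_sqrt_atTop.comp (tendsto_atTop_add_const_right _ _ tendsto_natCast_atTop_atTop))
  refine h.congr fun k => ?_
  rw [Real.norm_of_nonneg (by positivity), Real.norm_of_nonneg (by positivity),
    Nat.factorial_succ, Nat.cast_mul, Real.sqrt_mul (by positivity)]
  push_cast
  field_simp
  ring

/-- The bound for `1 / Γ(β - a k)` with `a ≤ 1 / 2` grows no faster than a geometric sequence times
`√(k!)`, so that the factor `1 / k!` of the Wright series dominates it. -/
theorem gammaInvBound_half_le (k : ℕ) :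
    gammaInvBound (k / 2 + 2) ≤ 24 * Real.exp 18 * (Real.exp 3 ^ k * Real.sqrt k.factorial) := by
  have hN : (0 : ℝ) ≤ (k : ℝ) + 6 := by positivity
  have h1 : ((k : ℝ) / 2 + 2 + 1) ^ ((k : ℝ) / 2 + 2) ≤
      Real.exp (k + 6) * (((k : ℝ) + 6) ^ 3 * Real.sqrt k.factorial) := by
    have e1 : ((k : ℝ) / 2 + 2 + 1) ^ ((k : ℝ) / 2 + 2) ≤ ((k : ℝ) + 6) ^ (((k : ℝ) + 6) / 2) :=
      (Real.rpow_le_rpow (by positivity) (by linarith) (by positivity)).trans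
        (Real.rpow_le_rpow_of_exponent_le (by linarith [(Nat.cast_nonneg k : (0:ℝ) ≤ k)])
          (by linarith))
    have e2 : ((k : ℝ) + 6) ^ (((k : ℝ) + 6) / 2) = Real.sqrt (((k : ℝ) + 6) ^ (k + 6)) := by
      rw [Real.sqrt_eq_rpow, ← Real.rpow_natCast, ← Real.rpow_mul hN]
      push_cast; ring_nf
    -- `n ^ n ≤ exp n * n!` with `n = k + 6`
    have e3 : ((k : ℝ) + 6) ^ (k + 6) ≤
        Real.exp (k + 6) ^ 2 * ((((k : ℝ) + 6) ^ 3) ^ 2 * k.factorial) := by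
      have f1 := Real.pow_div_factorial_le_exp ((k : ℝ) + 6) hN (k + 6)
      have f2 : ((k + 6).factorial : ℝ) ≤ k.factorial * ((k : ℝ) + 6) ^ 6 := by
        have f3 : (k + 6).factorial ≤ k.factorial * (k + 6) ^ 6 := by
          rw [← Nat.factorial_mul_ascFactorial]
          exact Nat.mul_le_mul_left _ (Nat.ascFactorial_le_pow_add k 6)
        exact_mod_cast f3
      rw [div_le_iff₀ (by positivity)] at f1
      have f4 : Real.exp ((k : ℝ) + 6) ≤ Real.exp (k + 6) ^ 2 :=
        le_self_pow₀ (Real.one_le_exp hN) two_ne_zero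
      calc _ ≤ _ := f1
        _ ≤ Real.exp (k + 6) ^ 2 * (k.factorial * ((k : ℝ) + 6) ^ 6) := by gcongr
        _ = _ := by ring
    rw [e2] at e1
    refine e1.trans (Real.sqrt_le_iff.2 ⟨by positivity, e3.trans_eq ?_⟩)
    rw [mul_pow, mul_pow, Real.sq_sqrt (by positivity)]
  have h2 : ((k : ℝ) + 6) ^ 4 ≤ 24 * Real.exp (k + 6) := by
    have := Real.pow_div_factorial_le_exp ((k : ℝ) + 6) hN 4
    rw [div_le_iff₀ (by positivity)] at this
    simpa [Nat.factorial, mul_comm] using this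
  unfold gammaInvBound
  calc ((k : ℝ) / 2 + 2) * (Real.exp ((k : ℝ) / 2 + 2) *
        ((k : ℝ) / 2 + 2 + 1) ^ ((k : ℝ) / 2 + 2))
      ≤ ((k : ℝ) + 6) * (Real.exp (k + 6) *
        (Real.exp (k + 6) * (((k : ℝ) + 6) ^ 3 * Real.sqrt k.factorial))) := by
        gcongr <;> linarith [(Nat.cast_nonneg k : (0:ℝ) ≤ k)]
    _ = ((k : ℝ) + 6) ^ 4 * (Real.exp (k + 6) * Real.exp (k + 6) * Real.sqrt k.factorial) := by
        ring
    _ ≤ (24 * Real.exp (k + 6)) * (Real.exp (k + 6) * Real.exp (k + 6) *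
          Real.sqrt k.factorial) := by gcongr
    _ = _ := by
        have : Real.exp ((k : ℝ) + 6) = Real.exp 1 ^ k * Real.exp 6 := by
          rw [Real.exp_add, ← Real.exp_nat_mul, mul_one]
        rw [this, show (18 : ℝ) = 6 + 6 + 6 by norm_num, show (3 : ℝ) = 1 + 1 + 1 by norm_num]
        simp only [Real.exp_add]
        ring

theorem summable_wright_majorant (R : ℝ) :
    Summable fun k : ℕ => |R| ^ k / k.factorial * gammaInvBound (k / 2 + 2) := by
  have h := (summable_pow_div_sqrt_factorial
    (D := (|R| + 1) * Real.exp 3) (by positivity)).mul_left (24 * Real.exp 18)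
  refine Summable.of_nonneg_of_le (fun k => ?_) (fun k => ?_) h
  · unfold gammaInvBound; positivity
  · calc |R| ^ k / k.factorial * gammaInvBound (k / 2 + 2)
        ≤ (|R| + 1) ^ k / k.factorial *
          (24 * Real.exp 18 * (Real.exp 3 ^ k * Real.sqrt k.factorial)) := by
          have := gammaInvBound_half_le k
          have h0 : 0 ≤ gammaInvBound ((k : ℝ) / 2 + 2) := by unfold gammaInvBound; positivity
          gcongr
          linarith
      _ = _ := by
          have hs : Real.sqrt k.factorial * Real.sqrt k.factorial = k.factorial :=
            Real.mul_self_sqrt (by positivity)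
          have hp : 0 < Real.sqrt k.factorial := by positivity
          rw [mul_pow]
          generalize Real.sqrt k.factorial = r at *
          rw [← hs]
          field_simp

/-! ### The Wright function: continuity, derivative, positivity -/

/-- The power series of `(1 - X) ^ (-γ)`; its coefficients are those of the Gauss product for
`1 / Γ(γ)`, up to normalization. -/
noncomputable def oneSubRPow (γ : ℝ) : PowerSeries ℝ :=
  PowerSeries.rescale (-1) (PowerSeries.binomialSeries ℝ (-γ))

theorem oneSubRPow_add (γ δ : ℝ) : oneSubRPow (γ + δ) = oneSubRPow γ * oneSubRPow δ := by
  rw [oneSubRPow, neg_add, PowerSeries.binomialSeries_add, map_mul]; rfl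

theorem oneSubRPow_zero : oneSubRPow 0 = 1 := by
  rw [oneSubRPow, neg_zero, PowerSeries.binomialSeries_zero, map_one]

theorem oneSubRPow_mul_nat (γ : ℝ) (n : ℕ) : oneSubRPow (n * γ) = oneSubRPow γ ^ n := by
  induction n with
  | zero => simp [oneSubRPow_zero]
  | succ n ih => rw [pow_succ, ← ih, ← oneSubRPow_add]; push_cast; ring_nf

theorem coeff_oneSubRPow (γ : ℝ) (n : ℕ) :
    PowerSeries.coeff n (oneSubRPow γ) =
      (∏ i ∈ Finset.range n, (γ + i)) / n.factorial := by
  have h1 := Polynomial.ascPochhammer_smeval_neg_eq_descPochhammer (-γ) n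
  rw [neg_neg, Polynomial.ascPochhammer_smeval_eq_eval] at h1
  have h2 : (ascPochhammer ℝ n).eval γ = ∏ i ∈ Finset.range n, (γ + i) := by
    clear h1
    induction n with
    | zero => simp
    | succ n ih => rw [ascPochhammer_succ_eval, ih, Finset.prod_range_succ]
  rw [oneSubRPow, PowerSeries.coeff_rescale, PowerSeries.binomialSeries_coeff,
    Ring.choose_eq_smul, ← h2, h1, ← Int.cast_negOnePow_natCast, ← zsmul_eq_mul]
  simp only [smul_eq_mul, mul_one, Units.smul_def, zsmul_eq_mul]
  ring

theorem coeff_mul_nonneg {f g : PowerSeries ℝ} (hf : ∀ n, 0 ≤ PowerSeries.coeff n f)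
    (hg : ∀ n, 0 ≤ PowerSeries.coeff n g) (n : ℕ) : 0 ≤ PowerSeries.coeff n (f * g) := by
  rw [PowerSeries.coeff_mul]
  exact Finset.sum_nonneg fun p _ => mul_nonneg (hf _) (hg _)

theorem coeff_pow_nonneg {f : PowerSeries ℝ} (hf : ∀ n, 0 ≤ PowerSeries.coeff n f) (k n : ℕ) :
    0 ≤ PowerSeries.coeff n (f ^ k) := by
  induction k generalizing n with
  | zero => rw [pow_zero, PowerSeries.coeff_one]; split_ifs <;> norm_num
  | succ k ih => rw [pow_succ]; exact coeff_mul_nonneg ih hf n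

theorem coeff_oneSubRPow_nonneg {β : ℝ} (hβ : 0 ≤ β) (n : ℕ) :
    0 ≤ PowerSeries.coeff n (oneSubRPow β) := by
  rw [coeff_oneSubRPow]; positivity

theorem coeff_oneSubRPow_neg_nonpos {a : ℝ} (ha : 0 ≤ a) (ha1 : a ≤ 1) (n : ℕ) :
    PowerSeries.coeff (n + 1) (oneSubRPow (-a)) ≤ 0 := by
  rw [coeff_oneSubRPow, Finset.prod_range_succ']
  refine div_nonpos_of_nonpos_of_nonneg (mul_nonpos_of_nonneg_of_nonpos
    (Finset.prod_nonneg fun i _ => ?_) (by simpa using ha)) (by positivity)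
  push_cast
  linarith [(Nat.cast_nonneg i : (0 : ℝ) ≤ i)]

theorem coeff_one_sub_smul_nonneg {a ε : ℝ} (ha : 0 ≤ a) (ha1 : a ≤ 1) (hε : 0 ≤ ε) (hε1 : ε ≤ 1)
    (n : ℕ) : 0 ≤ PowerSeries.coeff n (1 - ε • oneSubRPow (-a)) := by
  rw [map_sub, PowerSeries.coeff_smul]
  cases n with
  | zero => rw [coeff_oneSubRPow]; simpa using hε1
  | succ n =>
    have := coeff_oneSubRPow_neg_nonpos ha ha1 n
    rw [PowerSeries.coeff_one, if_neg (Nat.succ_ne_zero n), smul_eq_mul]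
    nlinarith

/-- The power series `(1 - ε (1 - X) ^ a) ^ n (1 - X) ^ (-β)` has nonnegative coefficients, expanded
by the binomial theorem. -/
theorem sum_choose_coeff_nonneg {a ε β : ℝ} (ha : 0 ≤ a) (ha1 : a ≤ 1) (hε : 0 ≤ ε)
    (hε1 : ε ≤ 1) (hβ : 0 ≤ β) (n m : ℕ) :
    0 ≤ ∑ k ∈ Finset.range (n + 1), (n.choose k : ℝ) * (-ε) ^ k *
      PowerSeries.coeff m (oneSubRPow (-a * k + β)) := by
  have h := coeff_mul_nonneg (coeff_pow_nonneg (coeff_one_sub_smul_nonneg ha ha1 hε hε1) n)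
    (coeff_oneSubRPow_nonneg hβ) m
  refine h.trans_eq ?_
  rw [sub_eq_neg_add, add_pow, Finset.sum_mul, map_sum]
  refine Finset.sum_congr rfl fun k _ => ?_
  rw [one_pow, mul_one, oneSubRPow_add, mul_comm (-a), oneSubRPow_mul_nat, ← neg_smul, smul_pow]
  rw [smul_mul_assoc, smul_mul_assoc, PowerSeries.coeff_smul, mul_assoc, mul_left_comm,
    ← nsmul_eq_mul, map_nsmul]
  simp only [smul_eq_mul, nsmul_eq_mul]
  ring

/-- The terms of the series of `W(-z; -a; β)`. -/
noncomputable def wrightTerm (a β z : ℝ) (k : ℕ) : ℝ :=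
  (-z) ^ k / ((k.factorial : ℝ) * Real.Gamma (-a * (k : ℝ) + β))

theorem wright_eq_tsum (a β z : ℝ) : wright (-z) (-a) β = ∑' k, wrightTerm a β z k := rfl

theorem abs_neg_mul_add_le {a β : ℝ} (ha : a ∈ Icc (0 : ℝ) (1 / 2)) (hβ : |β| ≤ 2) (k : ℕ) :
    |-a * (k : ℝ) + β| ≤ k / 2 + 2 := by
  have hk : (0 : ℝ) ≤ k := by positivity
  refine (abs_add_le _ _).trans (add_le_add ?_ hβ)
  rw [neg_mul, abs_neg, abs_of_nonneg (mul_nonneg ha.1 hk)]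
  nlinarith [ha.2]

theorem abs_wrightTerm_le {a β z R : ℝ} (ha : a ∈ Icc (0 : ℝ) (1 / 2)) (hβ : |β| ≤ 2)
    (hz : |z| ≤ |R|) (k : ℕ) :
    |wrightTerm a β z k| ≤ |R| ^ k / k.factorial * gammaInvBound (k / 2 + 2) := by
  have h1 := (abs_gamma_inv_le (-a * (k : ℝ) + β)).trans
    (gammaInvBound_mono (abs_nonneg _) (abs_neg_mul_add_le ha hβ k))
  rw [wrightTerm, div_mul_eq_div_div, div_eq_mul_inv _ (Real.Gamma _), abs_mul, abs_div, abs_pow,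
    abs_neg, Nat.abs_cast]
  gcongr

theorem summable_wrightTerm {a β : ℝ} (ha : a ∈ Icc (0 : ℝ) (1 / 2)) (hβ : |β| ≤ 2) (z : ℝ) :
    Summable (wrightTerm a β z) :=
  Summable.of_norm_bounded (summable_wright_majorant z) fun k =>
    abs_wrightTerm_le ha hβ le_rfl k

theorem wright_zero (ρ β : ℝ) : wright 0 ρ β = (Real.Gamma β)⁻¹ := by
  rw [wright, tsum_eq_single 0 (fun k hk => by simp [hk])]
  simp

/-- `W(-z; -a; β)` is jointly continuous in `z`, `a ∈ [0, 1 / 2]` and `β ∈ [-2, 2]`. -/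
theorem tendsto_wright {ι : Type*} {l : Filter ι} {z a β : ι → ℝ} {z₀ a₀ β₀ : ℝ}
    (hz : Tendsto z l (𝓝 z₀)) (ha : Tendsto a l (𝓝 a₀)) (hβ : Tendsto β l (𝓝 β₀))
    (ha' : ∀ᶠ i in l, a i ∈ Icc (0 : ℝ) (1 / 2)) (hβ' : ∀ᶠ i in l, |β i| ≤ 2) :
    Tendsto (fun i => wright (-(z i)) (-(a i)) (β i)) l (𝓝 (wright (-z₀) (-a₀) β₀)) := by
  simp only [wright_eq_tsum]
  refine tendsto_tsum_of_dominated_convergence (summable_wright_majorant (|z₀| + 1))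
    (fun k => ?_) ?_
  · simp only [wrightTerm, div_mul_eq_div_div, div_eq_mul_inv _ (Real.Gamma _)]
    exact ((hz.neg.pow k).div_const _).mul ((continuous_gamma_inv.tendsto _).comp
      ((ha.neg.mul_const _).add hβ))
  · have h1 : ∀ᶠ i in l, |z i| < |z₀| + 1 := hz.abs.eventually_lt_const (by linarith)
    filter_upwards [ha', hβ', h1] with i hi hi' hi1 k
    exact abs_wrightTerm_le hi hi' (hi1.le.trans (le_abs_self _)) k

/-- Termwise differentiation lowers the third parameter of the Wright function by `a`. -/
theorem hasDerivAt_wright {a β : ℝ} (ha : a ∈ Icc (0 : ℝ) (1 / 2)) (hβ : |β| ≤ 2)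
    (hβa : |β - a| ≤ 2) (z : ℝ) :
    HasDerivAt (fun z => wright (-z) (-a) β) (-wright (-z) (-a) (β - a)) z := by
  set g' : ℕ → ℝ → ℝ := fun n y =>
    (n : ℝ) * (-y) ^ (n - 1) * (-1) / ((n.factorial : ℝ) * Real.Gamma (-a * (n : ℝ) + β)) with hg'
  have hzero : ∀ y, g' 0 y = 0 := fun y => by simp [hg']
  have hsucc : ∀ n y, g' (n + 1) y = -wrightTerm a (β - a) y n := fun n y => by
    have e : -a * ((n + 1 : ℕ) : ℝ) + β = -a * n + (β - a) := by push_cast; ring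
    have h0 : ((n : ℝ) + 1) ≠ 0 := by positivity
    simp only [hg', wrightTerm, e, Nat.add_sub_cancel, Nat.factorial_succ]
    push_cast
    rw [mul_assoc, mul_assoc, mul_div_mul_left _ _ h0]
    ring
  set u : ℕ → ℝ := fun n =>
    (|(|z| + 1)|) ^ (n - 1) / (n - 1).factorial * gammaInvBound (((n - 1 : ℕ) : ℝ) / 2 + 2) with hu
  have hsum : Summable u := (summable_nat_add_iff 1).1 (by
    simpa [hu] using summable_wright_majorant (|z| + 1))
  have hmem : z ∈ Metric.ball (0 : ℝ) (|z| + 1) := by simp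
  have hd := hasDerivAt_tsum_of_isPreconnected (g := fun n y => wrightTerm a β y n) (g' := g')
    hsum Metric.isOpen_ball (convex_ball (0 : ℝ) (|z| + 1)).isPreconnected
    (fun n y _ => by
      have := (((hasDerivAt_id y).neg.pow n).div_const
        ((n.factorial : ℝ) * Real.Gamma (-a * (n : ℝ) + β)))
      simpa [hg', wrightTerm] using this)
    (fun n y hy => by
      cases n with
      | zero =>
        rw [hzero, norm_zero]
        simp only [hu, gammaInvBound]; positivity
      | succ n =>
        rw [hsucc, norm_neg]
        refine abs_wrightTerm_le ha hβa ?_ n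
        have : |y| < |z| + 1 := by simpa using hy
        exact this.le.trans (le_abs_self _))
    hmem (summable_wrightTerm ha hβ z) hmem
  refine hd.congr_deriv ?_
  have hs' : Summable fun n => g' n z := (summable_nat_add_iff 1).1 (by
    simpa only [hsucc] using (summable_wrightTerm ha hβa z).neg)
  rw [hs'.tsum_eq_zero_add, hzero, zero_add, wright_eq_tsum]
  simp only [hsucc, tsum_neg]

/-- Positivity of the Wright function on the negative half-line: `W(-z; -a; β)` is, up to positive
factors, the limit of the `(n + 1)`-st coefficients of
`(1 - ε (1 - X) ^ a) ^ n (1 - X) ^ (-β)` with `ε = z n ^ (a - 1)`. -/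
theorem wright_nonneg {a β z : ℝ} (ha : a ∈ Icc (0 : ℝ) (1 / 2)) (hβ0 : 0 ≤ β) (hβ : β ≤ 2)
    (hz : 0 ≤ z) : 0 ≤ wright (-z) (-a) β := by
  have hβ' : |β| ≤ 2 := by rwa [abs_of_nonneg hβ0]
  set f : ℕ → ℕ → ℝ := fun n k =>
    (n.choose k : ℝ) / (n : ℝ) ^ k * (-z) ^ k * (Real.GammaSeq (-a * k + β) n)⁻¹ with hf
  have hlim : Tendsto (fun n => ∑' k, f n k) atTop (𝓝 (wright (-z) (-a) β)) := by
    rw [wright_eq_tsum]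
    refine tendsto_tsum_of_dominated_convergence (summable_wright_majorant z) (fun k => ?_) ?_
    · have h1 : Tendsto (fun n : ℕ => (n.choose k : ℝ) / (n : ℝ) ^ k) atTop
          (𝓝 (1 / k.factorial)) := by
        have h := isEquivalent_choose k
        rw [Asymptotics.isEquivalent_iff_tendsto_one] at h
        · refine (h.mul_const (1 / (k.factorial : ℝ))).congr' ?_ |>.trans (by rw [one_mul])
          filter_upwards [eventually_ne_atTop 0] with n hn
          simp only [Pi.div_apply]
          field_simp
        · filter_upwards [eventually_ne_atTop 0] with n hn
          positivity
      have h2 := (h1.mul_const ((-z) ^ k)).mul (tendsto_gammaSeq_inv (-a * k + β))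
      refine h2.trans (le_of_eq ?_)
      rw [wrightTerm]; congr 1; field_simp
    · filter_upwards [eventually_ne_atTop 0] with n hn k
      have h1 := (abs_gammaSeq_inv_le (-a * (k : ℝ) + β) hn).trans
        (gammaInvBound_mono (abs_nonneg _) (abs_neg_mul_add_le ha hβ' k))
      have h2 : (n.choose k : ℝ) / (n : ℝ) ^ k ≤ 1 / k.factorial := by
        have := Nat.choose_le_pow_div (α := ℝ) k n
        rw [div_le_iff₀ (by positivity)]
        calc _ ≤ _ := this
          _ = _ := by ring
      rw [hf, Real.norm_eq_abs, abs_mul, abs_mul, abs_pow, abs_neg,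
        abs_of_nonneg (by positivity : 0 ≤ (n.choose k : ℝ) / (n : ℝ) ^ k)]
      calc _ ≤ 1 / k.factorial * |z| ^ k * gammaInvBound (k / 2 + 2) := by gcongr
        _ = _ := by ring
  -- `z n ^ a / n ≤ 1` for large `n`, as `a < 1`
  have hsmall : ∀ᶠ n : ℕ in atTop, z * (n : ℝ) ^ (a - 1) ≤ 1 := by
    have h0 : Tendsto (fun n : ℕ => z * (n : ℝ) ^ (a - 1)) atTop (𝓝 (z * 0)) := by
      refine Tendsto.const_mul z ?_
      have := (tendsto_rpow_neg_atTop (y := 1 - a) (by linarith [ha.2])).comp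
        (tendsto_natCast_atTop_atTop (R := ℝ))
      simpa [Function.comp_def] using this
    rw [mul_zero] at h0
    exact (h0.eventually_lt_const zero_lt_one).mono fun n h => h.le
  refine ge_of_tendsto hlim ?_
  filter_upwards [hsmall, eventually_ne_atTop 0] with n hn hn0
  have hn' : (0 : ℝ) < n := by positivity
  rw [tsum_eq_sum (s := Finset.range (n + 1)) (fun k hk => by
    have : n < k := by simpa [Nat.lt_succ_iff] using hk
    simp [hf, Nat.choose_eq_zero_of_lt this])]
  have h := sum_choose_coeff_nonneg (ε := z * (n : ℝ) ^ (a - 1)) ha.1 (by linarith [ha.2])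
    (by positivity) hn hβ0 n (n + 1)
  have h' := mul_nonneg (by positivity : 0 ≤ ((n : ℝ) + 1) * (n : ℝ) ^ (-β)) h
  refine h'.trans_eq ?_
  rw [Finset.mul_sum]
  refine Finset.sum_congr rfl fun k _ => ?_
  have e : (n : ℝ) ^ (-a * (k : ℝ) + β) = ((n : ℝ) ^ (a - 1)) ^ (-(k : ℝ)) * (n : ℝ) ^ β / n ^ k := by
    rw [← Real.rpow_mul hn'.le, ← Real.rpow_natCast, ← Real.rpow_add hn', ← Real.rpow_sub hn']
    congr 1; ring
  rw [coeff_oneSubRPow, hf]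
  simp only
  rw [gammaSeq_inv, e, Nat.factorial_succ, Real.rpow_neg hn'.le, Real.rpow_neg (by positivity),
    Real.rpow_natCast, neg_mul_eq_neg_mul, mul_pow]
  push_cast
  field_simp

/-! ### The transcendental equations and their limit -/

/-- Since `1 / Γ(s) = s / Γ(s + 1)`, the Wright function with third parameter `0` is a multiple of the
Mainardi function. For `a = 1 / 2` this is a first order linear equation for the latter. -/
theorem wright_zero_parameter {a : ℝ} (ha : a ∈ Ioc (0 : ℝ) (1 / 2)) (z : ℝ) :
    wright (-z) (-a) 0 = a * z * wright (-z) (-a) (1 - a) := by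
  have ha' : a ∈ Icc (0 : ℝ) (1 / 2) := ⟨ha.1.le, ha.2⟩
  rw [wright_eq_tsum, wright_eq_tsum, (summable_wrightTerm ha' (by simp) z).tsum_eq_zero_add,
    ← tsum_mul_left]
  have h0 : wrightTerm a 0 z 0 = 0 := by simp [wrightTerm]
  rw [h0, zero_add]
  refine tsum_congr fun k => ?_
  have hs : -a * ((k + 1 : ℕ) : ℝ) ≠ 0 := by
    have := ha.1
    push_cast
    exact mul_ne_zero (by linarith) (by positivity)
  have hG := Real.Gamma_add_one hs
  have hk : ((k : ℝ) + 1) ≠ 0 := by positivity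
  have e : -a * (k : ℝ) + (1 - a) = -a * ((k + 1 : ℕ) : ℝ) + 1 := by push_cast; ring
  rw [wrightTerm, wrightTerm, e, hG, add_zero, Nat.factorial_succ]
  have ha0 : a ≠ 0 := ha.1.ne'
  generalize Real.Gamma (-a * ((k + 1 : ℕ) : ℝ)) = G
  push_cast
  by_cases hG0 : G = 0
  · simp [hG0]
  · have hk' : -((k : ℝ) + 1) ≠ 0 := neg_ne_zero.2 hk
    field_simp
    ring

section Monotonicity

variable {a : ℝ}

theorem hasDerivAt_wright_one (ha : a ∈ Ioc (0 : ℝ) (1 / 2)) (z : ℝ) :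
    HasDerivAt (fun z => wright (-z) (-a) 1) (-wright (-z) (-a) (1 - a)) z :=
  hasDerivAt_wright ⟨ha.1.le, ha.2⟩ (by norm_num)
    (abs_le.2 ⟨by linarith [ha.1, ha.2], by linarith [ha.1, ha.2]⟩) z

theorem hasDerivAt_wright_one_sub (ha : a ∈ Ioc (0 : ℝ) (1 / 2)) (z : ℝ) :
    HasDerivAt (fun z => wright (-z) (-a) (1 - a)) (-wright (-z) (-a) (1 - a - a)) z :=
  hasDerivAt_wright ⟨ha.1.le, ha.2⟩
    (abs_le.2 ⟨by linarith [ha.1, ha.2], by linarith [ha.1, ha.2]⟩)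
    (abs_le.2 ⟨by linarith [ha.1, ha.2], by linarith [ha.1, ha.2]⟩) z

theorem hasDerivAt_wright_one_add (ha : a ∈ Ioc (0 : ℝ) (1 / 2)) (z : ℝ) :
    HasDerivAt (fun z => wright (-z) (-a) (1 + a)) (-wright (-z) (-a) 1) z := by
  have := hasDerivAt_wright (β := 1 + a) ⟨ha.1.le, ha.2⟩
    (abs_le.2 ⟨by linarith [ha.1, ha.2], by linarith [ha.1, ha.2]⟩)
    (abs_le.2 ⟨by linarith [ha.1, ha.2], by linarith [ha.1, ha.2]⟩) z
  rwa [add_sub_cancel_right] at this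

theorem wright_one_sub_nonneg (ha : a ∈ Ioc (0 : ℝ) (1 / 2)) {z : ℝ} (hz : 0 ≤ z) :
    0 ≤ wright (-z) (-a) (1 - a) :=
  wright_nonneg ⟨ha.1.le, ha.2⟩ (by linarith [ha.2]) (by linarith [ha.1]) hz

theorem antitoneOn_wright_one (ha : a ∈ Ioc (0 : ℝ) (1 / 2)) :
    AntitoneOn (fun z => wright (-z) (-a) 1) (Ici 0) := by
  refine antitoneOn_of_deriv_nonpos (convex_Ici 0)
    (fun z _ => (hasDerivAt_wright_one ha z).continuousAt.continuousWithinAt)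
    (fun z _ => (hasDerivAt_wright_one ha z).differentiableAt.differentiableWithinAt)
    fun z hz => ?_
  rw [interior_Ici] at hz
  rw [(hasDerivAt_wright_one ha z).deriv]
  exact neg_nonpos.2 (wright_one_sub_nonneg ha (le_of_lt hz))

theorem antitoneOn_wright_one_sub (ha : a ∈ Ioc (0 : ℝ) (1 / 2)) :
    AntitoneOn (fun z => wright (-z) (-a) (1 - a)) (Ici 0) := by
  refine antitoneOn_of_deriv_nonpos (convex_Ici 0)
    (fun z _ => (hasDerivAt_wright_one_sub ha z).continuousAt.continuousWithinAt)
    (fun z _ => (hasDerivAt_wright_one_sub ha z).differentiableAt.differentiableWithinAt)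
    fun z hz => ?_
  rw [interior_Ici] at hz
  rw [(hasDerivAt_wright_one_sub ha z).deriv]
  exact neg_nonpos.2 (wright_nonneg ⟨ha.1.le, ha.2⟩ (by linarith [ha.2]) (by linarith [ha.1])
    (le_of_lt hz))

theorem wright_zero_one (ρ : ℝ) : wright 0 ρ 1 = 1 := by
  rw [wright_zero, Real.Gamma_one, inv_one]

theorem wright_one_lt_one (ha : a ∈ Ioc (0 : ℝ) (1 / 2)) {z : ℝ} (hz : 0 < z) :
    wright (-z) (-a) 1 < 1 := by
  have hd := hasDerivAt_wright_one ha 0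
  have hpos : 0 < wright (-0) (-a) (1 - a) := by
    rw [neg_zero, wright_zero]
    exact inv_pos.2 (Real.Gamma_pos_of_pos (by linarith [ha.2]))
  have h1 := (hasDerivAt_iff_tendsto_slope.1 hd).mono_left
    (nhdsWithin_mono (0 : ℝ) (fun y (hy : y ∈ Ioi (0 : ℝ)) => (ne_of_gt hy : y ≠ 0)))
  have h2 := h1.eventually_lt_const (neg_lt_zero.2 hpos)
  obtain ⟨y, hy, hy0, hyz⟩ := (h2.and (Ioo_mem_nhdsGT hz)).exists
  rw [slope_def_field, sub_zero, div_lt_iff₀ hy0, zero_mul, neg_zero, wright_zero_one] at hy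
  have := antitoneOn_wright_one ha (mem_Ici.2 hy0.le) (mem_Ici.2 hz.le) hyz.le
  simp only at this
  linarith

end Monotonicity

/-- The difference of the two sides of the Caputo equation. -/
noncomputable def caputoFun (a x : ℝ) : ℝ :=
  2 * x * (1 - wright (-(2 * x)) (-a) 1) -
    wright (-(2 * x)) (-a) (1 - a) * (Real.Gamma (1 - a) / Real.Gamma (1 + a))

/-- The difference of the two sides of the Riemann–Liouville equation. -/
noncomputable def riemannLiouvilleFun (a x : ℝ) : ℝ :=
  2 * x * (1 - wright (-(2 * x)) (-a) 1) -
    (2 * x * wright (-(2 * x)) (-a) 1 + wright (-(2 * x)) (-a) (1 + a))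

theorem caputoEq_iff (α x : ℝ) : CaputoEq α x ↔ caputoFun (α / 2) x = 0 := sub_eq_zero.symm

theorem riemannLiouvilleEq_iff (α x : ℝ) :
    RiemannLiouvilleEq α x ↔ riemannLiouvilleFun (α / 2) x = 0 := sub_eq_zero.symm

theorem exists_isUniquePosRoot {F : ℝ → ℝ} (hc : Continuous F) (hm : StrictMonoOn F (Ici 0))
    (h0 : F 0 < 0) (h1 : ∃ y, 0 < y ∧ 0 ≤ F y) : ∃ c, IsUniquePosRoot (fun x => F x = 0) c := by
  obtain ⟨y, hy, hFy⟩ := h1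
  obtain ⟨c, hcm, hc0⟩ := intermediate_value_Icc hy.le hc.continuousOn ⟨h0.le, hFy⟩
  have hpos : 0 < c := hcm.1.lt_of_ne (by rintro rfl; exact h0.ne hc0)
  exact ⟨c, hpos, hc0, fun z hz hz0 =>
    hm.injOn (mem_Ici.2 hz.le) (mem_Ici.2 hpos.le) (hz0.trans hc0.symm)⟩

/-- Roots of strictly increasing functions converge if the functions converge pointwise to a strictly
increasing function with a root. -/
theorem tendsto_of_isUniquePosRoot {ι : Type*} {l : Filter ι} {F : ι → ℝ → ℝ} {G : ℝ → ℝ}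
    {c : ι → ℝ} {c₀ : ℝ} (hF : ∀ᶠ i in l, StrictMonoOn (F i) (Ici 0))
    (hG : StrictMonoOn G (Ici 0)) (hlim : ∀ x, 0 < x → Tendsto (fun i => F i x) l (𝓝 (G x)))
    (hc : ∀ᶠ i in l, IsUniquePosRoot (fun x => F i x = 0) (c i))
    (hc₀ : IsUniquePosRoot (fun x => G x = 0) c₀) : Tendsto c l (𝓝 c₀) := by
  refine tendsto_order.2 ⟨fun y hy => ?_, fun y hy => ?_⟩
  · have hy' : max y (c₀ / 2) < c₀ := max_lt hy (by linarith [hc₀.1])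
    have hy0 : 0 < max y (c₀ / 2) := lt_max_of_lt_right (by linarith [hc₀.1])
    have h := hG hy0.le hc₀.1.le hy'
    rw [hc₀.2.1] at h
    filter_upwards [hF, hc, (hlim _ hy0).eventually_lt_const h] with i h1 h2 h3
    refine lt_of_le_of_lt (le_max_left _ _) ((h1.lt_iff_lt hy0.le h2.1.le).1 ?_)
    rwa [h2.2.1]
  · have hy0 : 0 < y := hc₀.1.trans hy
    have h := hG hc₀.1.le hy0.le hy
    rw [hc₀.2.1] at h
    filter_upwards [hF, hc, (hlim _ hy0).eventually_const_lt h] with i h1 h2 h3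
    refine (h1.lt_iff_lt h2.1.le hy0.le).1 ?_
    rwa [h2.2.1]

section Roots

variable {a : ℝ}

/-- The first summand is a product of increasing factors, and the Mainardi function is decreasing
because `1 - 2 a ≥ 0`. -/
theorem strictMonoOn_caputoFun (ha : a ∈ Ioc (0 : ℝ) (1 / 2)) :
    StrictMonoOn (caputoFun a) (Ici 0) := by
  intro x hx y hy hxy
  have hx0 : (0 : ℝ) ≤ x := hx
  have hy0 : 0 < y := hx0.trans_lt hxy
  have h2 : 2 * x ≤ 2 * y := by linarith
  have h1 := antitoneOn_wright_one ha (mem_Ici.2 (by linarith : 0 ≤ 2 * x))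
    (mem_Ici.2 (by linarith : 0 ≤ 2 * y)) h2
  have h3 := antitoneOn_wright_one_sub ha (mem_Ici.2 (by linarith : 0 ≤ 2 * x))
    (mem_Ici.2 (by linarith : 0 ≤ 2 * y)) h2
  have h4 := wright_one_lt_one ha (by linarith : 0 < 2 * y)
  have hC : 0 < Real.Gamma (1 - a) / Real.Gamma (1 + a) :=
    div_pos (Real.Gamma_pos_of_pos (by linarith [ha.2]))
      (Real.Gamma_pos_of_pos (by linarith [ha.1]))
  have h5 := mul_le_mul_of_nonneg_right h3 hC.le
  simp only at h1 h3 h5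
  unfold caputoFun
  nlinarith

theorem continuous_caputoFun (ha : a ∈ Ioc (0 : ℝ) (1 / 2)) : Continuous (caputoFun a) := by
  have h1 : Continuous fun z => wright (-z) (-a) 1 :=
    continuous_iff_continuousAt.2 fun z => (hasDerivAt_wright_one ha z).continuousAt
  have h2 : Continuous fun z => wright (-z) (-a) (1 - a) :=
    continuous_iff_continuousAt.2 fun z => (hasDerivAt_wright_one_sub ha z).continuousAt
  have h3 : Continuous fun x : ℝ => 2 * x := continuous_const.mul continuous_id
  exact (h3.mul (continuous_const.sub (h1.comp h3))).sub ((h2.comp h3).mul continuous_const)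

theorem exists_isUniquePosRoot_caputoFun (ha : a ∈ Ioc (0 : ℝ) (1 / 2)) :
    ∃ c, IsUniquePosRoot (fun x => caputoFun a x = 0) c := by
  have hG : 0 < Real.Gamma (1 - a) := Real.Gamma_pos_of_pos (by linarith [ha.2])
  have hC : 0 < Real.Gamma (1 - a) / Real.Gamma (1 + a) :=
    div_pos hG (Real.Gamma_pos_of_pos (by linarith [ha.1]))
  refine exists_isUniquePosRoot (continuous_caputoFun ha) (strictMonoOn_caputoFun ha) ?_ ?_
  · simp only [caputoFun, mul_zero, neg_zero, wright_zero, zero_mul, zero_sub, neg_lt_zero]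
    positivity
  · have hδ : 0 < 1 - wright (-1) (-a) 1 := sub_pos.2 (wright_one_lt_one ha one_pos)
    set D := (Real.Gamma (1 - a))⁻¹ * (Real.Gamma (1 - a) / Real.Gamma (1 + a)) with hD
    have hD0 : 0 < D := by positivity
    refine ⟨1 + D / (1 - wright (-1) (-a) 1), by positivity, ?_⟩
    set y := 1 + D / (1 - wright (-1) (-a) 1) with hy
    have hy1 : 1 ≤ y := by rw [hy]; linarith [div_pos hD0 hδ]
    have hyD : D ≤ y * (1 - wright (-1) (-a) 1) := by
      rw [hy, add_mul, div_mul_cancel₀ _ hδ.ne']; linarith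
    have h1 := antitoneOn_wright_one ha (mem_Ici.2 zero_le_one)
      (mem_Ici.2 (by linarith : 0 ≤ 2 * y)) (by linarith)
    have h3 := antitoneOn_wright_one_sub ha (mem_Ici.2 le_rfl)
      (mem_Ici.2 (by linarith : 0 ≤ 2 * y)) (by linarith)
    simp only [neg_zero, wright_zero] at h1 h3
    have h5 := mul_le_mul_of_nonneg_right h3 hC.le
    unfold caputoFun
    nlinarith

/-- The derivative is positive for `x > 0`, as the Wright function is below `1` and the Mainardi
function is nonnegative. -/
theorem hasDerivAt_riemannLiouvilleFun (ha : a ∈ Ioc (0 : ℝ) (1 / 2)) (x : ℝ) :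
    HasDerivAt (riemannLiouvilleFun a)
      (2 * (1 - wright (-(2 * x)) (-a) 1 + 2 * (2 * x) * wright (-(2 * x)) (-a) (1 - a))) x := by
  have h2 : HasDerivAt (fun x : ℝ => 2 * x) 2 x := by
    simpa using (hasDerivAt_id x).const_mul 2
  have h1 : HasDerivAt (fun x => wright (-(2 * x)) (-a) 1) _ x :=
    (hasDerivAt_wright_one ha (2 * x)).comp x h2
  have h3 : HasDerivAt (fun x => wright (-(2 * x)) (-a) (1 + a)) _ x :=
    (hasDerivAt_wright_one_add ha (2 * x)).comp x h2
  exact ((h2.mul (h1.const_sub 1)).sub ((h2.mul h1).add h3)).congr_deriv (by ring)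

theorem strictMonoOn_riemannLiouvilleFun (ha : a ∈ Ioc (0 : ℝ) (1 / 2)) :
    StrictMonoOn (riemannLiouvilleFun a) (Ici 0) := by
  refine strictMonoOn_of_deriv_pos (convex_Ici 0)
    (fun x _ => (hasDerivAt_riemannLiouvilleFun ha x).continuousAt.continuousWithinAt)
    fun x hx => ?_
  rw [interior_Ici] at hx
  have hx' : (0 : ℝ) < 2 * x := by have : (0 : ℝ) < x := hx; linarith
  rw [(hasDerivAt_riemannLiouvilleFun ha x).deriv]
  have h1 := wright_one_lt_one ha hx'
  have h2 := mul_nonneg hx'.le (wright_one_sub_nonneg ha hx'.le)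
  linarith

theorem exists_isUniquePosRoot_riemannLiouvilleFun (ha : a ∈ Ioc (0 : ℝ) (1 / 2)) :
    ∃ c, IsUniquePosRoot (fun x => riemannLiouvilleFun a x = 0) c := by
  have hG : 0 < Real.Gamma (1 + a) := Real.Gamma_pos_of_pos (by linarith [ha.1])
  have hd := hasDerivAt_riemannLiouvilleFun ha
  have hc : Continuous (riemannLiouvilleFun a) :=
    continuous_iff_continuousAt.2 fun x => (hd x).continuousAt
  refine exists_isUniquePosRoot hc (strictMonoOn_riemannLiouvilleFun ha) ?_ ?_
  · simp only [riemannLiouvilleFun, mul_zero, neg_zero, wright_zero, zero_mul, zero_sub, zero_add,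
      neg_lt_zero]
    positivity
  · have hδ : 0 < 1 - wright (-1) (-a) 1 := sub_pos.2 (wright_one_lt_one ha one_pos)
    set δ := 1 - wright (-1) (-a) 1 with hδdef
    -- on `[1, ∞)` the derivative is at least `δ`
    have hslope : ∀ y, 1 ≤ y →
        δ * (y - 1) ≤ riemannLiouvilleFun a y - riemannLiouvilleFun a 1 := by
      intro y hy
      refine (convex_Ici (1 : ℝ)).mul_sub_le_image_sub_of_le_deriv hc.continuousOn
        (fun x _ => (hd x).differentiableAt.differentiableWithinAt) (fun x hx => ?_)
        1 (mem_Ici.2 le_rfl) y (mem_Ici.2 hy) hy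
      rw [interior_Ici] at hx
      have hx' : (1 : ℝ) < x := hx
      rw [(hd x).deriv]
      have h1 := antitoneOn_wright_one ha (mem_Ici.2 zero_le_one)
        (mem_Ici.2 (by linarith : 0 ≤ 2 * x)) (by linarith)
      have h2 := mul_nonneg (by linarith : 0 ≤ 2 * x)
        (wright_one_sub_nonneg ha (by linarith : 0 ≤ 2 * x))
      simp only at h1
      linarith
    refine ⟨1 + |riemannLiouvilleFun a 1| / δ, by positivity, ?_⟩
    have h := hslope (1 + |riemannLiouvilleFun a 1| / δ) (by
      linarith [div_nonneg (abs_nonneg (riemannLiouvilleFun a 1)) hδ.le])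
    rw [add_sub_cancel_left, mul_div_cancel₀ _ hδ.ne'] at h
    linarith [neg_abs_le (riemannLiouvilleFun a 1)]

end Roots

/-! ### The case `a = 1 / 2` -/

theorem hasDerivAt_erf (x : ℝ) :
    HasDerivAt erf (2 / Real.sqrt Real.pi * Real.exp (-x ^ 2)) x := by
  have hc : Continuous fun z : ℝ => Real.exp (-z ^ 2) := by fun_prop
  exact (hc.integral_hasStrictDerivAt 0 x).hasDerivAt.const_mul _

theorem erf_zero : erf 0 = 0 := by simp [erf]

theorem wright_half_half (z : ℝ) :
    wright (-z) (-(1 / 2)) (1 - 1 / 2) = Real.exp (-z ^ 2 / 4) / Real.sqrt Real.pi := by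
  have ha : (1 / 2 : ℝ) ∈ Ioc (0 : ℝ) (1 / 2) := ⟨by norm_num, le_rfl⟩
  have hd : ∀ z, HasDerivAt
      (fun z => wright (-z) (-(1 / 2)) (1 - 1 / 2) * Real.exp (z ^ 2 / 4)) 0 z := by
    intro z
    have h1 := hasDerivAt_wright_one_sub ha z
    rw [show (1 : ℝ) - 1 / 2 - 1 / 2 = 0 by norm_num, wright_zero_parameter ha] at h1
    have h2 : HasDerivAt (fun z : ℝ => Real.exp (z ^ 2 / 4))
        (Real.exp (z ^ 2 / 4) * (2 * z / 4)) z := by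
      simpa using ((hasDerivAt_pow 2 z).div_const 4).exp
    exact (h1.mul h2).congr_deriv (by ring)
  have hc := is_const_of_deriv_eq_zero (fun z => (hd z).differentiableAt) (fun z => (hd z).deriv)
    z 0
  simp only [neg_zero, wright_zero] at hc
  rw [show (1 : ℝ) - 1 / 2 = 1 / 2 by norm_num, Real.Gamma_one_half_eq] at hc
  rw [show (1 : ℝ) - 1 / 2 = 1 / 2 by norm_num, neg_div, Real.exp_neg]
  have hp := Real.exp_pos (z ^ 2 / 4)
  have hs : 0 < Real.sqrt Real.pi := Real.sqrt_pos.2 Real.pi_pos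
  field_simp
  simp at hc
  field_simp at hc
  linarith

theorem wright_half_one (z : ℝ) : wright (-z) (-(1 / 2)) 1 = 1 - erf (z / 2) := by
  have ha : (1 / 2 : ℝ) ∈ Ioc (0 : ℝ) (1 / 2) := ⟨by norm_num, le_rfl⟩
  have hd : ∀ z, HasDerivAt (fun z => wright (-z) (-(1 / 2)) 1 + erf (z / 2)) 0 z := by
    intro z
    have h1 := hasDerivAt_wright_one ha z
    rw [wright_half_half] at h1
    have h2 := HasDerivAt.comp (h₂ := erf) (h := fun z => z / 2) z (hasDerivAt_erf (z / 2))
      ((hasDerivAt_id z).div_const 2)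
    refine (h1.add h2).congr_deriv ?_
    rw [show -(z / 2) ^ 2 = -z ^ 2 / 4 by ring]
    ring
  have hc := is_const_of_deriv_eq_zero (fun z => (hd z).differentiableAt) (fun z => (hd z).deriv)
    z 0
  simp only [neg_zero, wright_zero_one, zero_div, erf_zero] at hc
  linarith

theorem wright_half_three_half (z : ℝ) :
    wright (-z) (-(1 / 2)) (1 + 1 / 2) =
      2 * wright (-z) (-(1 / 2)) (1 - 1 / 2) - z * wright (-z) (-(1 / 2)) 1 := by
  have ha : (1 / 2 : ℝ) ∈ Ioc (0 : ℝ) (1 / 2) := ⟨by norm_num, le_rfl⟩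
  have hd : ∀ z, HasDerivAt (fun z => wright (-z) (-(1 / 2)) (1 + 1 / 2) -
      (2 * wright (-z) (-(1 / 2)) (1 - 1 / 2) - z * wright (-z) (-(1 / 2)) 1)) 0 z := by
    intro z
    have h0 := hasDerivAt_wright_one_add ha z
    have h1 := hasDerivAt_wright_one ha z
    have h2 := hasDerivAt_wright_one_sub ha z
    rw [show (1 : ℝ) - 1 / 2 - 1 / 2 = 0 by norm_num, wright_zero_parameter ha] at h2
    exact (h0.sub ((h2.const_mul 2).sub ((hasDerivAt_id z).mul h1))).congr_deriv
      (by simp only [id]; ring)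
  have hc := is_const_of_deriv_eq_zero (fun z => (hd z).differentiableAt) (fun z => (hd z).deriv)
    z 0
  simp only [neg_zero, wright_zero, zero_mul, sub_zero] at hc
  have hG : Real.Gamma (1 + 1 / 2) = 1 / 2 * Real.Gamma (1 - 1 / 2) := by
    rw [add_comm, Real.Gamma_add_one (by norm_num)]; norm_num
  rw [hG, mul_inv] at hc
  norm_num at hc
  norm_num
  linarith

theorem caputoFun_half (x : ℝ) :
    caputoFun (1 / 2) x = 2 * (x * erf x - Real.exp (-x ^ 2) / Real.sqrt Real.pi) := by
  have hG : Real.Gamma (1 + 1 / 2) = 1 / 2 * Real.Gamma (1 - 1 / 2) := by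
    rw [add_comm, Real.Gamma_add_one (by norm_num)]; norm_num
  have hG0 : Real.Gamma (1 - 1 / 2) ≠ 0 := (Real.Gamma_pos_of_pos (by norm_num)).ne'
  have e : Real.Gamma (1 - 1 / 2) / Real.Gamma (1 + 1 / 2) = 2 := by
    rw [hG]; field_simp
  rw [caputoFun, e, wright_half_half, wright_half_one, show 2 * x / 2 = x by ring,
    show -(2 * x) ^ 2 / 4 = -x ^ 2 by ring]
  ring

theorem riemannLiouvilleFun_half (x : ℝ) : riemannLiouvilleFun (1 / 2) x = caputoFun (1 / 2) x := by
  rw [caputoFun_half, riemannLiouvilleFun, wright_half_three_half, wright_half_half,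
    wright_half_one, show 2 * x / 2 = x by ring, show -(2 * x) ^ 2 / 4 = -x ^ 2 by ring]
  ring

/-- The classical equation is the Caputo equation of order `1`. -/
theorem classicalEq_iff (x : ℝ) : ClassicalEq x ↔ caputoFun (1 / 2) x = 0 := by
  rw [caputoFun_half, ClassicalEq, ← sub_eq_zero]
  constructor <;> intro h <;> linarith

theorem tendsto_half : Tendsto (fun α : ℝ => α / 2) (𝓝[<] 1) (𝓝 (1 / 2)) :=
  ((continuous_id.div_const 2).tendsto (1 : ℝ)).mono_left nhdsWithin_le_nhds

theorem eventually_mem_Ioo_nhdsLT_one : ∀ᶠ α : ℝ in 𝓝[<] 1, α ∈ Ioo (0 : ℝ) 1 :=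
  Ioo_mem_nhdsLT zero_lt_one

theorem tendsto_wright_half {z β : ℝ → ℝ} {z₀ β₀ : ℝ} (hz : Tendsto z (𝓝[<] 1) (𝓝 z₀))
    (hβ : Tendsto β (𝓝[<] 1) (𝓝 β₀)) (hβ' : ∀ α ∈ Ioo (0 : ℝ) 1, |β α| ≤ 2) :
    Tendsto (fun α => wright (-(z α)) (-(α / 2)) (β α)) (𝓝[<] 1)
      (𝓝 (wright (-z₀) (-(1 / 2)) β₀)) := by
  refine tendsto_wright hz tendsto_half hβ ?_ ?_
  · filter_upwards [eventually_mem_Ioo_nhdsLT_one] with α hα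
    exact ⟨by linarith [hα.1], by linarith [hα.2]⟩
  · filter_upwards [eventually_mem_Ioo_nhdsLT_one] with α hα using hβ' α hα

theorem tendsto_caputoFun (x : ℝ) :
    Tendsto (fun α => caputoFun (α / 2) x) (𝓝[<] 1) (𝓝 (caputoFun (1 / 2) x)) := by
  have hG : Continuous fun s : ℝ => (Real.Gamma s)⁻¹ := continuous_gamma_inv
  have h1 := tendsto_wright_half (tendsto_const_nhds (x := 2 * x)) (tendsto_const_nhds (x := 1))
    (fun α _ => by norm_num)
  have h2 := tendsto_wright_half (tendsto_const_nhds (x := 2 * x)) (tendsto_half.const_sub 1)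
    (fun α hα => abs_le.2 ⟨by linarith [hα.1, hα.2], by linarith [hα.1, hα.2]⟩)
  have h3 := ((hG.tendsto _).comp (tendsto_half.const_sub 1)).inv₀
    (inv_ne_zero (Real.Gamma_pos_of_pos (by norm_num : (0 : ℝ) < 1 - 1 / 2)).ne')
  have h4 := (hG.tendsto _).comp (tendsto_half.const_add 1)
  have h5 := h3.mul h4
  simp only [Function.comp_def, inv_inv, ← div_eq_mul_inv] at h5
  exact ((h1.const_sub 1).const_mul (2 * x)).sub (h2.mul h5)

theorem tendsto_riemannLiouvilleFun (x : ℝ) :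
    Tendsto (fun α => riemannLiouvilleFun (α / 2) x) (𝓝[<] 1) (𝓝 (caputoFun (1 / 2) x)) := by
  rw [← riemannLiouvilleFun_half]
  have h1 := tendsto_wright_half (tendsto_const_nhds (x := 2 * x)) (tendsto_const_nhds (x := 1))
    (fun α _ => by norm_num)
  have h2 := tendsto_wright_half (tendsto_const_nhds (x := 2 * x)) (tendsto_half.const_add 1)
    (fun α hα => abs_le.2 ⟨by linarith [hα.1, hα.2], by linarith [hα.1, hα.2]⟩)
  exact ((h1.const_sub 1).const_mul (2 * x)).sub ((h1.const_mul (2 * x)).add h2)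

theorem erf_pos {x : ℝ} (hx : 0 < x) : 0 < erf x := by
  have h := wright_one_lt_one (a := 1 / 2) ⟨by norm_num, le_rfl⟩ (by linarith : 0 < 2 * x)
  rw [wright_half_one, show 2 * x / 2 = x by ring] at h
  linarith

theorem tendsto_fracTemp {c : ℝ → ℝ} {c₀ : ℝ} (hc₀ : 0 < c₀) (hc : Tendsto c (𝓝[<] 1) (𝓝 c₀))
    (x : ℝ) {t : ℝ} (ht : 0 < t) :
    Tendsto (fun α => fracTemp α (c α) x t) (𝓝[<] 1) (𝓝 (classicalTemp c₀ x t)) := by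
  have h1 := tendsto_wright_half (hc.const_mul 2) (tendsto_const_nhds (x := 1))
    (fun α _ => by norm_num)
  have hp : Tendsto (fun α : ℝ => t ^ (α / 2)) (𝓝[<] 1) (𝓝 (t ^ (1 / 2 : ℝ))) :=
    (Real.continuous_const_rpow ht.ne').continuousAt.tendsto.comp tendsto_half
  have hz := (tendsto_const_nhds (x := x)).div hp (Real.rpow_pos_of_pos ht _).ne'
  have h2 := tendsto_wright_half hz (tendsto_const_nhds (x := 1)) (fun α _ => by norm_num)
  rw [wright_half_one, show 2 * c₀ / 2 = c₀ by ring] at h1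
  rw [wright_half_one, ← Real.sqrt_eq_rpow, div_div, mul_comm (Real.sqrt t)] at h2
  have h3 := (tendsto_const_nhds (x := (1 : ℝ))).div (h1.const_sub 1)
    (by rw [sub_sub_cancel]; exact (erf_pos hc₀).ne')
  have h4 := (h3.mul (h2.const_sub 1)).const_sub 1
  simp only [sub_sub_cancel] at h4
  exact h4

theorem tendsto_fracFront {c : ℝ → ℝ} {c₀ : ℝ} (hc : Tendsto c (𝓝[<] 1) (𝓝 c₀))
    {t : ℝ} (ht : 0 ≤ t) :
    Tendsto (fun α => fracFront α (c α) t) (𝓝[<] 1) (𝓝 (classicalFront c₀ t)) := by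
  rw [classicalFront, Real.sqrt_eq_rpow]
  refine (hc.const_mul 2).mul ?_
  rcases ht.eq_or_lt with rfl | ht
  · rw [Real.zero_rpow (by norm_num)]
    refine tendsto_const_nhds.congr' ?_
    filter_upwards [eventually_mem_Ioo_nhdsLT_one] with α hα
    rw [Real.zero_rpow (by linarith [hα.1])]
  · exact (Real.continuous_const_rpow ht.ne').continuousAt.tendsto.comp tendsto_half

/-! ### The heat equation in domains with a moving boundary -/

/-- `v` satisfies the heat equation `v_t = v_xx` at `(x, t)`, with `v_x` existing at all points near
`x` at time `t`. No continuity of the derivatives is required. -/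
def IsCaloricAt (v : ℝ → ℝ → ℝ) (x t : ℝ) : Prop :=
  ∃ (d : ℝ) (g : ℝ → ℝ), HasDerivAt (fun τ => v x τ) d t ∧
    (∀ᶠ y in 𝓝 x, HasDerivAt (fun y => v y t) (g y) y) ∧ HasDerivAt g d x

namespace IsCaloricAt

variable {v w : ℝ → ℝ → ℝ} {x t : ℝ}

theorem sub (hv : IsCaloricAt v x t) (hw : IsCaloricAt w x t) :
    IsCaloricAt (fun x t => v x t - w x t) x t := by
  obtain ⟨d, g, h1, h2, h3⟩ := hv
  obtain ⟨d', g', h1', h2', h3'⟩ := hw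
  exact ⟨d - d', fun y => g y - g' y, h1.sub h1', (h2.and h2').mono fun y hy => hy.1.sub hy.2,
    h3.sub h3'⟩

theorem const (c : ℝ) : IsCaloricAt (fun _ _ => c) x t :=
  ⟨0, fun _ => 0, hasDerivAt_const _ _, Eventually.of_forall fun _ => hasDerivAt_const _ _,
    hasDerivAt_const _ _⟩

theorem const_mul (c : ℝ) (hv : IsCaloricAt v x t) : IsCaloricAt (fun x t => c * v x t) x t := by
  obtain ⟨d, g, h1, h2, h3⟩ := hv
  exact ⟨c * d, fun y => c * g y, h1.const_mul c, h2.mono fun y hy => hy.const_mul c,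
    h3.const_mul c⟩

theorem comp_add_const (δ : ℝ) (hv : IsCaloricAt v x (t + δ)) :
    IsCaloricAt (fun x t => v x (t + δ)) x t := by
  obtain ⟨d, g, h1, h2, h3⟩ := hv
  exact ⟨d, g, h1.comp_add_const t δ, h2, h3⟩

theorem of_deriv (h1 : DifferentiableAt ℝ (fun τ => v x τ) t)
    (h2 : ∀ᶠ y in 𝓝 x, DifferentiableAt ℝ (fun y => v y t) y)
    (h3 : DifferentiableAt ℝ (deriv fun y => v y t) x)
    (h4 : deriv (fun τ => v x τ) t = deriv (deriv fun y => v y t) x) : IsCaloricAt v x t :=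
  ⟨_, _, h1.hasDerivAt, h2.mono fun _ hy => hy.hasDerivAt, h4 ▸ h3.hasDerivAt⟩

theorem differentiableAt_time (h : IsCaloricAt v x t) : DifferentiableAt ℝ (fun τ => v x τ) t := by
  obtain ⟨d, g, h1, h2, h3⟩ := h
  exact h1.differentiableAt

theorem differentiableAt_space (h : IsCaloricAt v x t) :
    DifferentiableAt ℝ (fun y => v y t) x := by
  obtain ⟨d, g, h1, h2, h3⟩ := h
  exact h2.self_of_nhds.differentiableAt

theorem hasDerivAt_deriv (h : IsCaloricAt v x t) :
    HasDerivAt (deriv fun y => v y t) (deriv (fun τ => v x τ) t) x := by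
  obtain ⟨d, g, h1, h2, h3⟩ := h
  rw [h1.deriv]
  exact h3.congr_of_eventuallyEq (h2.mono fun y hy => hy.deriv)

end IsCaloricAt

/-- The region between `0` and the graph of a nonnegative continuous function on a compact interval is
compact, as the image of a rectangle. -/
theorem isCompact_subgraph {σ : ℝ → ℝ} {t₁ t₂ : ℝ} (hσ : ContinuousOn σ (Icc t₁ t₂))
    (hσ0 : ∀ t ∈ Icc t₁ t₂, 0 ≤ σ t) :
    IsCompact {p : ℝ × ℝ | p.2 ∈ Icc t₁ t₂ ∧ p.1 ∈ Icc 0 (σ p.2)} := by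
  have h : {p : ℝ × ℝ | p.2 ∈ Icc t₁ t₂ ∧ p.1 ∈ Icc 0 (σ p.2)} =
      (fun q : ℝ × ℝ => (q.1 * σ q.2, q.2)) '' (Icc 0 1 ×ˢ Icc t₁ t₂) := by
    ext ⟨x, t⟩
    constructor
    · rintro ⟨ht, hx⟩
      refine ⟨(x / σ t, t), ⟨⟨div_nonneg hx.1 (hσ0 t ht), div_le_one_of_le₀ hx.2 (hσ0 t ht)⟩, ht⟩,
        Prod.ext ?_ rfl⟩
      by_cases h0 : σ t = 0
      · have : x = 0 := le_antisymm (h0 ▸ hx.2) hx.1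
        simp [this]
      · exact div_mul_cancel₀ x h0
    · rintro ⟨⟨θ, τ⟩, ⟨hθ, hτ⟩, he⟩
      obtain ⟨rfl, rfl⟩ := Prod.mk.inj he
      exact ⟨hτ, mul_nonneg hθ.1 (hσ0 _ hτ), mul_le_of_le_one_left (hσ0 _ hτ) hθ.2⟩
  rw [h]
  refine (isCompact_Icc.prod isCompact_Icc).image_of_continuousOn ?_
  exact (continuousOn_fst.mul (hσ.comp continuousOn_snd fun q hq => hq.2)).prodMk continuousOn_snd

theorem not_isLocalMax_of_hasDerivAt_pos {f g : ℝ → ℝ} {x d : ℝ}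
    (hf : ∀ᶠ y in 𝓝 x, HasDerivAt f (g y) y) (hg : HasDerivAt g d x) (hd : 0 < d) :
    ¬ IsLocalMax f x := by
  intro hmax
  have hfg : deriv f =ᶠ[𝓝 x] g := hf.mono fun y hy => hy.deriv
  have hdd : deriv (deriv f) x = d := (hg.congr_of_eventuallyEq hfg).deriv
  have hmin := isLocalMin_of_deriv_deriv_pos (hdd ▸ hd) hmax.deriv_eq_zero
    hf.self_of_nhds.continuousAt
  have hc : f =ᶠ[𝓝 x] fun _ => f x := by
    filter_upwards [hmax, hmin] with y h1 h2 using le_antisymm h1 h2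
  have h0 : deriv (deriv f) x = 0 := by
    rw [hc.deriv.deriv_eq]; simp
  linarith

/-- Weak maximum principle, with the heat equation required at the final time as well. At a maximum of
`v - κ (t - t₁)` inside the domain or on its top, `v_t ≥ κ > 0` while `v_xx ≤ 0`. -/
theorem caloric_le_of_parabolic_boundary_of_Ioc {σ : ℝ → ℝ} {v : ℝ → ℝ → ℝ} {t₁ t₂ : ℝ}
    (hσ : ContinuousOn σ (Icc t₁ t₂)) (hσ0 : ∀ t ∈ Icc t₁ t₂, 0 ≤ σ t)
    (hv : ContinuousOn (fun p : ℝ × ℝ => v p.1 p.2)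
      {p | p.2 ∈ Icc t₁ t₂ ∧ p.1 ∈ Icc 0 (σ p.2)})
    (hcal : ∀ t ∈ Ioc t₁ t₂, ∀ x ∈ Ioo 0 (σ t), IsCaloricAt v x t)
    (hbot : ∀ x ∈ Icc 0 (σ t₁), v x t₁ ≤ 0) (hleft : ∀ t ∈ Icc t₁ t₂, v 0 t ≤ 0)
    (hright : ∀ t ∈ Icc t₁ t₂, v (σ t) t ≤ 0) :
    ∀ t ∈ Icc t₁ t₂, ∀ x ∈ Icc 0 (σ t), v x t ≤ 0 := by
  intro t ht x hx
  by_contra! hpos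
  -- penalize by a small multiple of time
  set κ := v x t / (2 * (t₂ - t₁ + 1)) with hκ
  have hlen : 0 < t₂ - t₁ + 1 := by linarith [ht.1, ht.2]
  have hκ0 : 0 < κ := by positivity
  obtain ⟨⟨x₀, t₀⟩, ⟨ht₀, hx₀⟩, hmax⟩ := (isCompact_subgraph hσ hσ0).exists_isMaxOn
    ⟨(x, t), ht, hx⟩ (hv.sub (Continuous.continuousOn
      (f := fun p : ℝ × ℝ => κ * (p.2 - t₁)) (by fun_prop)))
  simp only at ht₀ hx₀
  have hle : ∀ y τ, τ ∈ Icc t₁ t₂ → y ∈ Icc 0 (σ τ) →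
      v y τ - κ * (τ - t₁) ≤ v x₀ t₀ - κ * (t₀ - t₁) := fun y τ hτ hy =>
    hmax (show (y, τ) ∈ {p : ℝ × ℝ | p.2 ∈ Icc t₁ t₂ ∧ p.1 ∈ Icc 0 (σ p.2)} from ⟨hτ, hy⟩)
  have hv₀ : 0 < v x₀ t₀ := by
    have h1 := hle x t ht hx
    have h2 : κ * (t - t₁) ≤ v x t / 2 := by
      have : κ * (t₂ - t₁ + 1) = v x t / 2 := by rw [hκ]; field_simp
      nlinarith [ht.2]
    nlinarith [mul_nonneg hκ0.le (sub_nonneg.2 ht₀.1)]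
  have ht₀1 : t₁ < t₀ := ht₀.1.lt_of_ne (by
    rintro rfl; exact absurd (hbot x₀ hx₀) (not_le.2 hv₀))
  have hx₀0 : 0 < x₀ := hx₀.1.lt_of_ne (by
    rintro rfl; exact absurd (hleft t₀ ht₀) (not_le.2 hv₀))
  have hx₀1 : x₀ < σ t₀ := hx₀.2.lt_of_ne (by
    rintro rfl; exact absurd (hright t₀ ht₀) (not_le.2 hv₀))
  obtain ⟨d, g, h1, h2, h3⟩ := hcal t₀ ⟨ht₀1, ht₀.2⟩ x₀ ⟨hx₀0, hx₀1⟩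
  have hd : κ ≤ d := by
    have hs := (hasDerivAt_iff_tendsto_slope.1 h1).mono_left
      (nhdsWithin_mono t₀ (fun y (hy : y ∈ Iio t₀) => (ne_of_lt hy : y ≠ t₀)))
    refine ge_of_tendsto hs ?_
    have hσ₀ : Tendsto σ (𝓝[<] t₀) (𝓝 (σ t₀)) := by
      refine ((hσ t₀ ht₀).mono_of_mem_nhdsWithin ?_ : ContinuousWithinAt σ (Iio t₀) t₀)
      exact mem_of_superset (Ioo_mem_nhdsLT ht₀1) fun y hy => ⟨hy.1.le, hy.2.le.trans ht₀.2⟩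
    filter_upwards [hσ₀.eventually_const_lt hx₀1, Ioo_mem_nhdsLT ht₀1] with τ hτ hτ'
    have := hle x₀ τ ⟨hτ'.1.le, hτ'.2.le.trans ht₀.2⟩ ⟨hx₀0.le, hτ.le⟩
    rw [slope_def_field, le_div_iff_of_neg (by linarith [hτ'.2])]
    linarith
  refine not_isLocalMax_of_hasDerivAt_pos h2 h3 (hκ0.trans_le hd) ?_
  filter_upwards [Ioo_mem_nhds hx₀0 hx₀1] with y hy
  have := hle y t₀ ht₀ ⟨hy.1.le, hy.2.le⟩
  linarith

/-- Weak maximum principle below a moving boundary `σ`, with the heat equation before the final time. -/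
theorem caloric_le_of_parabolic_boundary {σ : ℝ → ℝ} {v : ℝ → ℝ → ℝ} {t₁ t₂ : ℝ}
    (hσ : ContinuousOn σ (Icc t₁ t₂)) (hσ0 : ∀ t ∈ Icc t₁ t₂, 0 ≤ σ t)
    (hv : ContinuousOn (fun p : ℝ × ℝ => v p.1 p.2)
      {p | p.2 ∈ Icc t₁ t₂ ∧ p.1 ∈ Icc 0 (σ p.2)})
    (hcal : ∀ t ∈ Ioo t₁ t₂, ∀ x ∈ Ioo 0 (σ t), IsCaloricAt v x t)
    (hbot : ∀ x ∈ Icc 0 (σ t₁), v x t₁ ≤ 0) (hleft : ∀ t ∈ Icc t₁ t₂, v 0 t ≤ 0)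
    (hright : ∀ t ∈ Icc t₁ t₂, v (σ t) t ≤ 0) :
    ∀ t ∈ Icc t₁ t₂, ∀ x ∈ Icc 0 (σ t), v x t ≤ 0 := by
  have hlt : ∀ t ∈ Ico t₁ t₂, ∀ x ∈ Icc 0 (σ t), v x t ≤ 0 := by
    intro t ht
    have hsub : Icc t₁ t ⊆ Icc t₁ t₂ := Icc_subset_Icc_right ht.2.le
    exact caloric_le_of_parabolic_boundary_of_Ioc (hσ.mono hsub) (fun τ hτ => hσ0 τ (hsub hτ))
      (hv.mono fun p hp => ⟨hsub hp.1, hp.2⟩)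
      (fun τ hτ => hcal τ ⟨hτ.1, hτ.2.trans_lt ht.2⟩) hbot (fun τ hτ => hleft τ (hsub hτ))
      (fun τ hτ => hright τ (hsub hτ)) t ⟨ht.1, le_rfl⟩
  intro t ht x hx
  rcases ht.2.lt_or_eq with h | rfl
  · exact hlt t ⟨ht.1, h⟩ x hx
  rcases ht.1.eq_or_lt with rfl | h1
  · exact hbot x hx
  rcases hx.1.eq_or_lt with rfl | hx0
  · exact hleft t ht
  rcases hx.2.eq_or_lt with rfl | hx1
  · exact hright t ht
  -- interior points at the final time are limits of interior points at earlier times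
  have hσt : Tendsto σ (𝓝[<] t) (𝓝 (σ t)) := by
    refine ((hσ t ht).mono_of_mem_nhdsWithin ?_ : ContinuousWithinAt σ (Iio t) t)
    exact mem_of_superset (Ioo_mem_nhdsLT h1) fun y hy => ⟨hy.1.le, hy.2.le⟩
  have hev : ∀ᶠ τ in 𝓝[<] t, τ ∈ Ico t₁ t ∧ x ∈ Icc 0 (σ τ) := by
    filter_upwards [hσt.eventually_const_lt hx1, Ioo_mem_nhdsLT h1] with τ hτ hτ'
    exact ⟨⟨hτ'.1.le, hτ'.2⟩, hx0.le, hτ.le⟩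
  have hlim : Tendsto (fun τ => v x τ) (𝓝[<] t) (𝓝 (v x t)) := by
    have hpair : Tendsto (fun τ => (x, τ)) (𝓝[<] t)
        (𝓝[{p : ℝ × ℝ | p.2 ∈ Icc t₁ t ∧ p.1 ∈ Icc 0 (σ p.2)}] (x, t)) :=
      tendsto_nhdsWithin_iff.2
        ⟨((Continuous.prodMk_right x).tendsto t).mono_left nhdsWithin_le_nhds,
          hev.mono fun τ hτ => ⟨⟨hτ.1.1, hτ.1.2.le⟩, hτ.2⟩⟩
    exact (hv (x, t) ⟨ht, hx⟩).tendsto.comp hpair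
  exact le_of_tendsto hlim (hev.mono fun τ hτ => hlt τ hτ.1 x hτ.2)

/-- The heat kernel, up to the constant factor `1 / √(4 π)`. -/
noncomputable def gaussian (x t : ℝ) : ℝ := (Real.sqrt t)⁻¹ * Real.exp (-x ^ 2 / (4 * t))

theorem gaussian_nonneg (x t : ℝ) : 0 ≤ gaussian x t := by unfold gaussian; positivity

theorem hasDerivAt_gaussian_space (x t : ℝ) :
    HasDerivAt (fun y => gaussian y t) (-x / (2 * t) * gaussian x t) x := by
  have h : HasDerivAt (fun y : ℝ => -y ^ 2 / (4 * t)) (-(2 * x) / (4 * t)) x := by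
    simpa using (hasDerivAt_pow 2 x).neg.div_const (4 * t)
  refine (h.exp.const_mul _).congr_deriv ?_
  rw [gaussian]
  have : -(2 * x) / (4 * t) = -x / (2 * t) := by
    rw [show -(2 * x) = 2 * -x by ring, show 4 * t = 2 * (2 * t) by ring,
      mul_div_mul_left _ _ two_ne_zero]
  rw [this]; ring

theorem isCaloricAt_gaussian (x : ℝ) {t : ℝ} (ht : 0 < t) : IsCaloricAt gaussian x t := by
  refine ⟨(x ^ 2 / (4 * t ^ 2) - 1 / (2 * t)) * gaussian x t, fun y => -y / (2 * t) * gaussian y t,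
    ?_, Eventually.of_forall fun y => hasDerivAt_gaussian_space y t, ?_⟩
  · have h1 := (Real.hasDerivAt_sqrt ht.ne').inv (Real.sqrt_pos.2 ht).ne'
    have h2 : HasDerivAt (fun τ : ℝ => -x ^ 2 / (4 * τ)) (x ^ 2 / (4 * t ^ 2)) t := by
      have := ((hasDerivAt_id t).const_mul 4).fun_inv (by simpa using ht.ne')
      refine ((this.const_mul (-x ^ 2)).congr_deriv ?_)
      simp only [id]; field_simp
    refine (h1.mul h2.exp).congr_deriv ?_
    rw [gaussian, Real.sq_sqrt ht.le]
    have hs := Real.sqrt_pos.2 ht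
    simp only [Pi.inv_apply]
    field_simp
    ring
  · have h1 : HasDerivAt (fun y : ℝ => -y / (2 * t)) (-1 / (2 * t)) x :=
      (hasDerivAt_id x).neg.div_const _
    refine (h1.mul (hasDerivAt_gaussian_space x t)).congr_deriv ?_
    field_simp
    ring

theorem continuousOn_gaussian :
    ContinuousOn (fun p : ℝ × ℝ => gaussian p.1 p.2) {p | 0 < p.2} := by
  unfold gaussian
  refine ContinuousOn.mul (ContinuousOn.inv₀ (by fun_prop) fun p hp => (Real.sqrt_pos.2 hp).ne') ?_
  refine Real.continuous_exp.comp_continuousOn (ContinuousOn.div (by fun_prop) (by fun_prop) ?_)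
  intro p hp
  have : 0 < p.2 := hp
  positivity

/-- Maximum principle of Phragmén–Lindelöf type for a domain that starts from the single point
`(0, 0)`: boundedness replaces a condition on `v` at that corner. From time `ε` on, `v` is bounded by
a multiple of `σ ε` times a Gaussian that starts with width `σ ε`; this bound tends to `0` with
`ε`. -/
theorem caloric_le_of_lateral_boundary {σ : ℝ → ℝ} {v : ℝ → ℝ → ℝ} {T : ℝ}
    (hσ : ContinuousOn σ (Icc 0 T)) (hσz : σ 0 = 0) (hσ0 : ∀ t ∈ Ioc 0 T, 0 < σ t)
    (hv : ContinuousOn (fun p : ℝ × ℝ => v p.1 p.2)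
      {p | p.2 ∈ Ioc 0 T ∧ p.1 ∈ Icc 0 (σ p.2)})
    (hbdd : ∃ C, ∀ t ∈ Ioc 0 T, ∀ x ∈ Icc 0 (σ t), v x t ≤ C)
    (hcal : ∀ t ∈ Ioo 0 T, ∀ x ∈ Ioo 0 (σ t), IsCaloricAt v x t)
    (hleft : ∀ t ∈ Ioc 0 T, v 0 t ≤ 0) (hright : ∀ t ∈ Ioc 0 T, v (σ t) t ≤ 0) :
    ∀ t ∈ Ioc 0 T, ∀ x ∈ Icc 0 (σ t), v x t ≤ 0 := by
  intro t ht x hx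
  obtain ⟨C₀, hC₀⟩ := hbdd
  obtain ⟨C, hC0, hC⟩ : ∃ C, 0 ≤ C ∧ ∀ t ∈ Ioc 0 T, ∀ x ∈ Icc 0 (σ t), v x t ≤ C :=
    ⟨max C₀ 0, le_max_right _ _, fun t ht x hx => (hC₀ t ht x hx).trans (le_max_left _ _)⟩
  set A := C * Real.exp (1 / 4) with hA
  have hA0 : 0 ≤ A := by positivity
  have key : ∀ ε ∈ Ioo 0 t, v x t ≤ A * σ ε * (Real.sqrt (t - ε))⁻¹ := by
    intro ε hε
    have hσε : 0 < σ ε := hσ0 ε ⟨hε.1, hε.2.le.trans ht.2⟩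
    have hsub : Icc ε t ⊆ Ioc 0 T := fun τ hτ => ⟨hε.1.trans_le hτ.1, hτ.2.trans ht.2⟩
    set δ := σ ε ^ 2 - ε with hδ
    have hpos : ∀ τ, ε ≤ τ → 0 < τ + δ := fun τ hτ => by
      have : 0 < σ ε ^ 2 := by positivity
      rw [hδ]; linarith
    have hb : 0 ≤ A * σ ε := by positivity
    have h := caloric_le_of_parabolic_boundary (σ := σ) (t₁ := ε) (t₂ := t)
      (v := fun x τ => v x τ - A * σ ε * gaussian x (τ + δ))
      (hσ.mono fun τ hτ => ⟨(hsub hτ).1.le, (hsub hτ).2⟩) (fun τ hτ => (hσ0 τ (hsub hτ)).le)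
      ((hv.mono fun p hp => ⟨hsub hp.1, hp.2⟩).sub
        (continuousOn_const.mul (continuousOn_gaussian.comp
          (f := fun p : ℝ × ℝ => (p.1, p.2 + δ)) (by fun_prop) fun p hp => hpos _ hp.1.1)))
      (fun τ hτ y hy => (hcal τ ⟨hε.1.trans hτ.1, hτ.2.trans_le ht.2⟩ y hy).sub
        (((isCaloricAt_gaussian y (hpos τ hτ.1.le)).comp_add_const δ).const_mul (A * σ ε)))
      ?_ (fun τ hτ => ?_) (fun τ hτ => ?_) t ⟨hε.2.le, le_rfl⟩ x hx
    · have hg : gaussian x (t + δ) ≤ (Real.sqrt (t - ε))⁻¹ := by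
        have h0 : 0 < Real.sqrt (t - ε) := Real.sqrt_pos.2 (by linarith [hε.2])
        have h1 : Real.sqrt (t - ε) ≤ Real.sqrt (t + δ) := Real.sqrt_le_sqrt (by
          rw [hδ]; nlinarith)
        have h2 : Real.exp (-x ^ 2 / (4 * (t + δ))) ≤ 1 := by
          rw [Real.exp_le_one_iff]
          exact div_nonpos_of_nonpos_of_nonneg (by nlinarith)
            (by linarith [hpos t hε.2.le])
        calc gaussian x (t + δ) ≤ (Real.sqrt (t + δ))⁻¹ * 1 :=
              mul_le_mul_of_nonneg_left h2 (by positivity)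
          _ ≤ _ := by rw [mul_one]; exact inv_anti₀ h0 h1
      linarith [mul_le_mul_of_nonneg_left hg hb]
    · intro y hy
      -- at time `ε` the barrier is at least `C` on `[0, σ ε]`
      have h1 : Real.exp (-(1 / 4)) ≤ Real.exp (-y ^ 2 / (4 * σ ε ^ 2)) := by
        apply Real.exp_le_exp.2
        rw [neg_div, neg_le_neg_iff, div_le_div_iff₀ (by positivity) (by norm_num)]
        nlinarith [hy.1, hy.2]
      have h2 : C ≤ A * σ ε * gaussian y (ε + δ) := by
        rw [show ε + δ = σ ε ^ 2 by rw [hδ]; ring, gaussian, Real.sqrt_sq hσε.le]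
        calc C = C * (Real.exp (1 / 4) * Real.exp (-(1 / 4))) := by
              rw [← Real.exp_add]; simp
          _ ≤ C * (Real.exp (1 / 4) * Real.exp (-y ^ 2 / (4 * σ ε ^ 2))) := by gcongr
          _ = _ := by rw [hA]; field_simp
      linarith [hC ε ⟨hε.1, hε.2.le.trans ht.2⟩ y hy]
    · linarith [hleft τ (hsub hτ), mul_nonneg hb (gaussian_nonneg 0 (τ + δ))]
    · linarith [hright τ (hsub hτ), mul_nonneg hb (gaussian_nonneg (σ τ) (τ + δ))]
  have hT : 0 ≤ T := ht.1.le.trans ht.2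
  have hσlim : Tendsto σ (𝓝[>] 0) (𝓝 0) := by
    have : ContinuousWithinAt σ (Ioi 0) 0 := (hσ 0 ⟨le_rfl, hT⟩).mono_of_mem_nhdsWithin
      (mem_of_superset (Ioo_mem_nhdsGT (ht.1.trans_le ht.2)) fun y hy => ⟨hy.1.le, hy.2.le⟩)
    simpa [ContinuousWithinAt, hσz] using this
  have hsq : Tendsto (fun ε : ℝ => (Real.sqrt (t - ε))⁻¹) (𝓝[>] 0) (𝓝 (Real.sqrt (t - 0))⁻¹) := by
    refine Tendsto.inv₀ ?_ (by rw [sub_zero]; exact (Real.sqrt_pos.2 ht.1).ne')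
    exact ((by fun_prop : Continuous fun ε : ℝ => Real.sqrt (t - ε)).tendsto 0).mono_left
      nhdsWithin_le_nhds
  have hlim := (hσlim.const_mul A).mul hsq
  rw [mul_zero, zero_mul] at hlim
  exact ge_of_tendsto hlim (mem_of_superset (Ioo_mem_nhdsGT ht.1) key)

/-! ### Uniqueness for the Stefan problem -/

theorem strictMono_erf : StrictMono erf := by
  refine strictMono_of_deriv_pos fun x => ?_
  rw [(hasDerivAt_erf x).deriv]
  have := Real.sqrt_pos.2 Real.pi_pos
  positivity

theorem continuous_erf : Continuous erf :=
  continuous_iff_continuousAt.2 fun x => (hasDerivAt_erf x).continuousAt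

theorem hasDerivAt_classicalTemp_space (c x : ℝ) {t : ℝ} (ht : 0 < t) :
    HasDerivAt (fun y => classicalTemp c y t)
      (-(1 / erf c / Real.sqrt Real.pi) * gaussian x t) x := by
  have h := HasDerivAt.comp (h₂ := erf) (h := fun y => y / (2 * Real.sqrt t)) x
    (hasDerivAt_erf _) ((hasDerivAt_id x).div_const _)
  refine ((h.const_mul (1 / erf c)).const_sub 1).congr_deriv ?_
  rw [gaussian, div_pow, mul_pow, Real.sq_sqrt ht.le, ← neg_div]
  norm_num
  ring

theorem isCaloricAt_classicalTemp (c x : ℝ) {t : ℝ} (ht : 0 < t) :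
    IsCaloricAt (classicalTemp c) x t := by
  refine ⟨-(1 / erf c / Real.sqrt Real.pi) * (-x / (2 * t) * gaussian x t), _, ?_,
    Eventually.of_forall fun y => hasDerivAt_classicalTemp_space c y ht,
    (hasDerivAt_gaussian_space x t).const_mul _⟩
  have hs := Real.sqrt_pos.2 ht
  have h0 := ((Real.hasDerivAt_sqrt ht.ne').const_mul 2).fun_inv (by positivity)
  have h := HasDerivAt.comp (h₂ := erf) (h := fun τ => x * (2 * Real.sqrt τ)⁻¹) t
    (hasDerivAt_erf _) (h0.const_mul x)
  refine ((h.const_mul (1 / erf c)).const_sub 1).congr_deriv ?_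
  rw [gaussian, mul_pow, inv_pow, mul_pow, Real.sq_sqrt ht.le]
  have e : -(x ^ 2 * (2 ^ 2 * t)⁻¹) = -x ^ 2 / (4 * t) := by
    rw [neg_div, div_eq_mul_inv]; norm_num
  rw [e]
  have : t = Real.sqrt t ^ 2 := (Real.sq_sqrt ht.le).symm
  generalize Real.exp (-x ^ 2 / (4 * t)) = E
  generalize hr : Real.sqrt t = r at *
  rw [this]
  field_simp

theorem continuousOn_classicalTemp (c : ℝ) :
    ContinuousOn (fun p : ℝ × ℝ => classicalTemp c p.1 p.2) {p | 0 < p.2} := by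
  unfold classicalTemp
  refine continuousOn_const.sub (continuousOn_const.mul
    (continuous_erf.comp_continuousOn (ContinuousOn.div (by fun_prop) (by fun_prop) ?_)))
  intro p hp
  have : 0 < Real.sqrt p.2 := Real.sqrt_pos.2 hp
  positivity

theorem classicalTemp_zero (c t : ℝ) : classicalTemp c 0 t = 1 := by
  simp [classicalTemp, erf_zero]

theorem classicalTemp_front {c t : ℝ} (hc : 0 < c) (ht : 0 < t) :
    classicalTemp c (classicalFront c t) t = 0 := by
  have hs := Real.sqrt_pos.2 ht
  have he := erf_pos hc
  rw [classicalTemp, classicalFront, mul_right_comm, mul_div_cancel_left₀ _ (by positivity)]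
  field_simp
  ring

theorem antitone_classicalTemp {c t : ℝ} (hc : 0 < c) (ht : 0 < t) :
    Antitone fun x => classicalTemp c x t := by
  intro x y hxy
  have he := erf_pos hc
  have hs := Real.sqrt_pos.2 ht
  have h : erf (x / (2 * Real.sqrt t)) ≤ erf (y / (2 * Real.sqrt t)) :=
    strictMono_erf.monotone (by gcongr)
  simp only [classicalTemp]
  have := mul_le_mul_of_nonneg_left h (by positivity : 0 ≤ 1 / erf c)
  linarith

theorem classicalTemp_nonneg {c x t : ℝ} (hc : 0 < c) (ht : 0 < t)
    (hx : x ≤ classicalFront c t) : 0 ≤ classicalTemp c x t :=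
  (classicalTemp_front hc ht).symm.le.trans (antitone_classicalTemp hc ht hx)

theorem classicalTemp_le_one {c x t : ℝ} (hc : 0 < c) (ht : 0 < t) (hx : 0 ≤ x) :
    classicalTemp c x t ≤ 1 :=
  (antitone_classicalTemp hc ht hx).trans (classicalTemp_zero c t).le

theorem hasDerivAt_classicalTemp_front {c t : ℝ} (ht : 0 < t) :
    HasDerivAt (fun y => classicalTemp c y t)
      (-(Real.exp (-c ^ 2) / Real.sqrt Real.pi / erf c / Real.sqrt t)) (classicalFront c t) := by
  refine (hasDerivAt_classicalTemp_space c _ ht).congr_deriv ?_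
  have hs := Real.sqrt_pos.2 ht
  have e : -classicalFront c t ^ 2 / (4 * t) = -c ^ 2 := by
    rw [classicalFront, mul_pow, Real.sq_sqrt ht.le]; field_simp; ring
  rw [gaussian, e]
  ring

theorem hasDerivAt_classicalFront (c : ℝ) {t : ℝ} (ht : 0 < t) :
    HasDerivAt (classicalFront c) (c / Real.sqrt t) t := by
  refine ((Real.hasDerivAt_sqrt ht.ne').const_mul (2 * c)).congr_deriv ?_
  have hs := Real.sqrt_pos.2 ht
  field_simp

theorem continuous_classicalFront (c : ℝ) : Continuous (classicalFront c) := by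
  unfold classicalFront; fun_prop

theorem classicalFront_pos {c t : ℝ} (hc : 0 < c) (ht : 0 < t) : 0 < classicalFront c t := by
  have hs := Real.sqrt_pos.2 ht
  unfold classicalFront; positivity

theorem classicalFront_zero (c : ℝ) : classicalFront c 0 = 0 := by simp [classicalFront]

theorem isClassicalSolution_classicalTemp {c : ℝ} (hc : 0 < c) (heq : ClassicalEq c) (T : ℝ) :
    IsClassicalSolution T (classicalTemp c) (classicalFront c) where
  front_zero := classicalFront_zero c
  front_pos t ht := classicalFront_pos hc ht.1
  front_continuous := (continuous_classicalFront c).continuousOn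
  temp_continuous := (continuousOn_classicalTemp c).mono fun p hp => hp.1.1
  temp_bounded := ⟨1, fun t ht x hx => abs_le.2
    ⟨by linarith [classicalTemp_nonneg hc ht.1 hx.2], classicalTemp_le_one hc ht.1 hx.1⟩⟩
  diff_t t ht x _ := (isCaloricAt_classicalTemp c x ht.1).differentiableAt_time
  diff_x t ht x _ := (isCaloricAt_classicalTemp c x ht.1).differentiableAt_space
  diff_xx t ht x _ := (isCaloricAt_classicalTemp c x ht.1).hasDerivAt_deriv.differentiableAt
  heat t ht x _ := (isCaloricAt_classicalTemp c x ht.1).hasDerivAt_deriv.deriv.symm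
  fixed_face t _ := classicalTemp_zero c t
  front_temp t ht := classicalTemp_front hc ht.1
  diff_front t ht :=
    (hasDerivAt_classicalTemp_front ht.1).differentiableAt.differentiableWithinAt
  stefan t ht := by
    have hpos := classicalFront_pos hc ht.1
    rw [(hasDerivAt_classicalTemp_front ht.1).hasDerivWithinAt.derivWithin
      (uniqueDiffOn_Icc hpos _ (right_mem_Icc.2 hpos.le)), neg_neg, ← show c * erf c = _ from heq,
      mul_div_cancel_right₀ _ (erf_pos hc).ne']
    exact (hasDerivAt_classicalFront c ht.1).hasDerivWithinAt

/-- If `f` starts below `g` and cannot touch `g` for a first time, then it stays below `g`. -/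
theorem lt_of_no_contact {f g : ℝ → ℝ} {T : ℝ} (hf : ContinuousOn f (Icc 0 T))
    (hg : ContinuousOn g (Icc 0 T)) (h0 : f 0 < g 0)
    (h : ∀ t ∈ Ioc 0 T, (∀ τ ∈ Ico 0 t, f τ < g τ) → f t ≠ g t) :
    ∀ t ∈ Icc 0 T, f t < g t := by
  by_contra! hex
  obtain ⟨t, ht, hgf⟩ := hex
  have hcpt : IsCompact {t ∈ Icc 0 T | g t ≤ f t} :=
    isCompact_Icc.of_isClosed_subset (isClosed_Icc.isClosed_le hg hf) fun _ h => h.1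
  obtain ⟨t₀, ⟨ht₀, hle⟩, hmin⟩ := hcpt.exists_isLeast ⟨t, ht, hgf⟩
  have hpos : 0 < t₀ := ht₀.1.lt_of_ne (by rintro rfl; linarith)
  have hbefore : ∀ τ ∈ Ico 0 t₀, f τ < g τ := fun τ hτ => by
    by_contra! hc
    exact absurd (hmin ⟨⟨hτ.1, hτ.2.le.trans ht₀.2⟩, hc⟩) (not_le.2 hτ.2)
  have hmem : Icc 0 T ∈ 𝓝[<] t₀ :=
    mem_of_superset (Ioo_mem_nhdsLT hpos) fun y hy => ⟨hy.1.le, hy.2.le.trans ht₀.2⟩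
  have h1 : Tendsto f (𝓝[<] t₀) (𝓝 (f t₀)) :=
    ((hf t₀ ht₀).mono_of_mem_nhdsWithin hmem : ContinuousWithinAt f (Iio t₀) t₀)
  have h2 : Tendsto g (𝓝[<] t₀) (𝓝 (g t₀)) :=
    ((hg t₀ ht₀).mono_of_mem_nhdsWithin hmem : ContinuousWithinAt g (Iio t₀) t₀)
  have h3 : f t₀ ≤ g t₀ := le_of_tendsto_of_tendsto h1 h2
    (mem_of_superset (Ioo_mem_nhdsLT hpos) fun y hy => (hbefore y ⟨hy.1.le, hy.2⟩).le)
  exact h t₀ ⟨hpos, ht₀.2⟩ hbefore (le_antisymm h3 hle)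

/-- If `f ≤ g` to the left of `b` and `f b = g b`, then the left derivative of `f` at `b` is at least
that of `g`. -/
theorem hasDerivWithinAt_le_of_contact {f g : ℝ → ℝ} {f' g' a b : ℝ} {s : Set ℝ} (hab : a < b)
    (hs : Ioo a b ⊆ s) (hf : HasDerivWithinAt f f' s b) (hg : HasDerivWithinAt g g' s b)
    (hle : ∀ y ∈ Ioo a b, f y ≤ g y) (heq : f b = g b) : g' ≤ f' := by
  have hmem : s ∈ 𝓝[<] b := mem_of_superset (Ioo_mem_nhdsLT hab) hs
  have hf' := hasDerivWithinAt_iff_tendsto_slope.1 (hf.mono_of_mem_nhdsWithin hmem)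
  have hg' := hasDerivWithinAt_iff_tendsto_slope.1 (hg.mono_of_mem_nhdsWithin hmem)
  rw [sdiff_singleton_eq_self self_notMem_Iio] at hf' hg'
  refine le_of_tendsto_of_tendsto hg' hf' (mem_of_superset (Ioo_mem_nhdsLT hab) fun y hy => ?_)
  simp only [mem_ofPred_eq, slope_def_field]
  exact div_le_div_of_nonpos_of_le (by linarith [hy.2]) (by linarith [hle y hy])

namespace IsClassicalSolution

variable {T : ℝ} {u : ℝ → ℝ → ℝ} {s : ℝ → ℝ}

theorem isCaloricAt (h : IsClassicalSolution T u s) {t x : ℝ} (ht : t ∈ Ioo 0 T)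
    (hx : x ∈ Ioo 0 (s t)) : IsCaloricAt u x t :=
  .of_deriv (h.diff_t t ht x hx) (mem_of_superset (Ioo_mem_nhds hx.1 hx.2) (h.diff_x t ht))
    (h.diff_xx t ht x hx) (h.heat t ht x hx)

theorem temp_nonneg (h : IsClassicalSolution T u s) :
    ∀ t ∈ Ioc 0 T, ∀ x ∈ Icc 0 (s t), 0 ≤ u x t := by
  obtain ⟨C, hC⟩ := h.temp_bounded
  have := caloric_le_of_lateral_boundary (v := fun x t => 0 - u x t) h.front_continuous
    h.front_zero h.front_pos (continuousOn_const.sub h.temp_continuous)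
    ⟨C, fun t ht x hx => by linarith [(abs_le.1 (hC t ht x hx)).1]⟩
    (fun t ht x hx => (IsCaloricAt.const 0).sub (h.isCaloricAt ht hx))
    (fun t ht => by rw [h.fixed_face t ht]; norm_num)
    (fun t ht => by rw [h.front_temp t ht]; norm_num)
  exact fun t ht x hx => by linarith [this t ht x hx]

/-- Comparison with the supersolution `lam * classicalTemp c x (t + δ)`. Its temperature at the fixed
face exceeds `1`, and its front `classicalFront c (t + δ)` starts ahead of `s` and moves strictly faster
than its own heat flux prescribes. At a first contact the ordering of the temperatures orders the
heat fluxes, so `s` would move strictly slower than the front that it has just reached. -/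
theorem front_lt_of_supersolution (h : IsClassicalSolution T u s) {c lam δ : ℝ} (hc : 0 < c)
    (hδ : 0 < δ) (hlam : 1 < lam)
    (hslow : lam * (Real.exp (-c ^ 2) / Real.sqrt Real.pi) < c * erf c) :
    ∀ t ∈ Icc 0 T, s t < classicalFront c (t + δ) := by
  have hshift : Continuous fun t : ℝ => t + δ := by fun_prop
  refine lt_of_no_contact h.front_continuous
    ((continuous_classicalFront c).comp hshift).continuousOn
    (by rw [h.front_zero, zero_add]; exact classicalFront_pos hc hδ) fun t ht hbefore heq => ?_
  have hsub : Ioc 0 t ⊆ Ioc 0 T := Ioc_subset_Ioc_right ht.2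
  have hpos : ∀ τ, 0 < τ → 0 < τ + δ := fun τ hτ => by linarith
  have hle : ∀ τ ∈ Ioc 0 t, s τ ≤ classicalFront c (τ + δ) := fun τ hτ => by
    rcases hτ.2.lt_or_eq with h1 | rfl
    · exact (hbefore τ ⟨hτ.1.le, h1⟩).le
    · exact heq.le
  obtain ⟨C, hC⟩ := h.temp_bounded
  -- up to the contact time the temperature is below that of the supersolution
  have hcomp := caloric_le_of_lateral_boundary
    (v := fun x τ => u x τ - lam * classicalTemp c x (τ + δ))
    (h.front_continuous.mono (Icc_subset_Icc_right ht.2)) h.front_zero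
    (fun τ hτ => h.front_pos τ (hsub hτ))
    ((h.temp_continuous.mono fun p hp => ⟨hsub hp.1, hp.2⟩).sub
      (continuousOn_const.mul ((continuousOn_classicalTemp c).comp
        (f := fun p : ℝ × ℝ => (p.1, p.2 + δ)) (by fun_prop) fun p hp => hpos _ hp.1.1)))
    ⟨C, fun τ hτ x hx => by
      have h1 := classicalTemp_nonneg hc (hpos τ hτ.1) (hx.2.trans (hle τ hτ))
      have h2 := (abs_le.1 (hC τ (hsub hτ) x hx)).2
      nlinarith⟩
    (fun τ hτ x hx => (h.isCaloricAt (t := τ) ⟨hτ.1, hτ.2.trans_le ht.2⟩ hx).sub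
      (((isCaloricAt_classicalTemp c x (hpos τ hτ.1)).comp_add_const δ).const_mul lam))
    (fun τ hτ => by rw [h.fixed_face τ (hsub hτ), classicalTemp_zero]; linarith)
    (fun τ hτ => by
      have h1 := classicalTemp_nonneg hc (hpos τ hτ.1) (hle τ hτ)
      rw [h.front_temp τ (hsub hτ)]
      nlinarith)
    t ⟨ht.1, le_rfl⟩
  have hst := h.front_pos t ht
  have hw := (hasDerivAt_classicalTemp_front (c := c) (hpos t ht.1)).const_mul lam
  rw [← heq] at hw
  have hspace := hasDerivWithinAt_le_of_contact hst Ioo_subset_Icc_self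
    (h.diff_front t ht).hasDerivWithinAt hw.hasDerivWithinAt
    (fun y hy => sub_nonpos.1 (hcomp y ⟨hy.1.le, hy.2.le⟩))
    (by rw [h.front_temp t ht, heq, classicalTemp_front hc (hpos t ht.1), mul_zero])
  have htime := hasDerivWithinAt_le_of_contact ht.1
    (s := Icc 0 T) (fun y hy => ⟨hy.1.le, hy.2.le.trans ht.2⟩)
    (h.stefan t ht)
    ((hasDerivAt_classicalFront c (hpos t ht.1)).comp_add_const t δ).hasDerivWithinAt
    (fun y hy => (hbefore y ⟨hy.1.le, hy.2⟩).le) heq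
  have hs := Real.sqrt_pos.2 (hpos t ht.1)
  have he := erf_pos hc
  have : lam * (Real.exp (-c ^ 2) / Real.sqrt Real.pi / erf c / Real.sqrt (t + δ)) <
      c / Real.sqrt (t + δ) := by
    rw [← mul_div_assoc, div_lt_div_iff_of_pos_right hs, ← mul_div_assoc, div_lt_iff₀ he]
    exact hslow
  linarith

/-- Comparison with the subsolution `lam * classicalTemp c x (t - δ)`, which starts from the corner at
time `δ`, when `s` is already positive; time is shifted by `δ` in the statement. -/
theorem lt_front_of_subsolution (h : IsClassicalSolution T u s) {c lam δ : ℝ} (hc : 0 < c)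
    (hδ : 0 < δ) (hδT : δ < T) (hlam0 : 0 ≤ lam) (hlam : lam < 1)
    (hfast : c * erf c < lam * (Real.exp (-c ^ 2) / Real.sqrt Real.pi)) :
    ∀ t ∈ Icc 0 (T - δ), classicalFront c t < s (t + δ) := by
  have hmaps : MapsTo (fun t : ℝ => t + δ) (Icc 0 (T - δ)) (Icc 0 T) :=
    fun t ht => ⟨by linarith [ht.1], by linarith [ht.2]⟩
  have hmem : ∀ t ∈ Ioc 0 (T - δ), t + δ ∈ Ioc 0 T :=
    fun t ht => ⟨by linarith [ht.1], by linarith [ht.2]⟩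
  refine lt_of_no_contact (continuous_classicalFront c).continuousOn
    (h.front_continuous.comp (by fun_prop) hmaps)
    (by rw [classicalFront_zero, zero_add]; exact h.front_pos δ ⟨hδ, hδT.le⟩)
    fun t ht hbefore heq => ?_
  have hsub : Ioc 0 t ⊆ Ioc 0 (T - δ) := Ioc_subset_Ioc_right ht.2
  have hle : ∀ τ ∈ Ioc 0 t, classicalFront c τ ≤ s (τ + δ) := fun τ hτ => by
    rcases hτ.2.lt_or_eq with h1 | rfl
    · exact (hbefore τ ⟨hτ.1.le, h1⟩).le
    · exact heq.le
  -- up to the contact time the temperature is above that of the subsolution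
  have hcomp := caloric_le_of_lateral_boundary
    (v := fun x τ => lam * classicalTemp c x τ - u x (τ + δ))
    (continuous_classicalFront c).continuousOn (classicalFront_zero c)
    (fun τ hτ => classicalFront_pos hc hτ.1)
    ((continuousOn_const.mul ((continuousOn_classicalTemp c).mono fun p hp => hp.1.1)).sub
      (h.temp_continuous.comp (f := fun p : ℝ × ℝ => (p.1, p.2 + δ)) (by fun_prop)
        fun p hp => ⟨hmem _ (hsub hp.1), hp.2.1, hp.2.2.trans (hle _ hp.1)⟩))
    ⟨lam, fun τ hτ x hx => by
      have h1 := classicalTemp_le_one hc hτ.1 hx.1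
      have h2 := h.temp_nonneg _ (hmem τ (hsub hτ)) x ⟨hx.1, hx.2.trans (hle τ hτ)⟩
      nlinarith⟩
    (fun τ hτ x hx => ((isCaloricAt_classicalTemp c x hτ.1).const_mul lam).sub
      ((h.isCaloricAt (t := τ + δ) ⟨by linarith [hτ.1], by linarith [hτ.2, ht.2]⟩
        ⟨hx.1, hx.2.trans_le (hle τ ⟨hτ.1, hτ.2.le⟩)⟩).comp_add_const δ))
    (fun τ hτ => by
      rw [h.fixed_face _ (hmem τ (hsub hτ)), classicalTemp_zero]; linarith)
    (fun τ hτ => by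
      have h1 := h.temp_nonneg _ (hmem τ (hsub hτ)) _
        ⟨(classicalFront_pos hc hτ.1).le, hle τ hτ⟩
      rw [classicalTemp_front hc hτ.1]
      linarith)
    t ⟨ht.1, le_rfl⟩
  have ht' := hmem t ht
  have hst := h.front_pos _ ht'
  have hw := (hasDerivAt_classicalTemp_front (c := c) ht.1).const_mul lam
  have hu := (h.diff_front _ ht').hasDerivWithinAt
  rw [heq] at hw
  have hspace := hasDerivWithinAt_le_of_contact hst Ioo_subset_Icc_self hw.hasDerivWithinAt hu
    (fun y hy => sub_nonpos.1 (hcomp y ⟨hy.1.le, by rw [heq]; exact hy.2.le⟩))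
    (by rw [h.front_temp _ ht', ← heq, classicalTemp_front hc ht.1, mul_zero])
  have hs' : HasDerivWithinAt (fun τ => s (τ + δ)) _ (Icc 0 (T - δ)) t :=
    HasDerivWithinAt.comp_of_eq (h₂ := s) t (h.stefan _ ht')
      ((hasDerivAt_id t).add_const δ).hasDerivWithinAt hmaps rfl
  have htime := hasDerivWithinAt_le_of_contact ht.1
    (s := Icc 0 (T - δ)) (fun y hy => ⟨hy.1.le, hy.2.le.trans ht.2⟩)
    (hasDerivAt_classicalFront c ht.1).hasDerivWithinAt hs'
    (fun y hy => (hbefore y ⟨hy.1.le, hy.2⟩).le) heq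
  have hs := Real.sqrt_pos.2 ht.1
  have he := erf_pos hc
  have : c / Real.sqrt t <
      lam * (Real.exp (-c ^ 2) / Real.sqrt Real.pi / erf c / Real.sqrt t) := by
    rw [← mul_div_assoc, div_lt_div_iff_of_pos_right hs, ← mul_div_assoc, lt_div_iff₀ he]
    exact hfast
  linarith

end IsClassicalSolution

/-- For `c` above the root, a factor larger than `1` is left for the boundary temperature of a
supersolution. -/
theorem lt_mul_erf {η c : ℝ} (hη : IsUniquePosRoot ClassicalEq η) (hc : η < c) :
    Real.exp (-c ^ 2) / Real.sqrt Real.pi < c * erf c := by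
  have h := strictMonoOn_caputoFun (a := 1 / 2) ⟨by norm_num, le_rfl⟩ (mem_Ici.2 hη.1.le)
    (mem_Ici.2 (hη.1.trans hc).le) hc
  rw [(classicalEq_iff η).1 hη.2.1, caputoFun_half] at h
  linarith

/-- For `c` below the root, a factor smaller than `1` is left for the boundary temperature of a
subsolution. -/
theorem mul_erf_lt {η c : ℝ} (hη : IsUniquePosRoot ClassicalEq η) (hc0 : 0 < c) (hc : c < η) :
    c * erf c < Real.exp (-c ^ 2) / Real.sqrt Real.pi := by
  have h := strictMonoOn_caputoFun (a := 1 / 2) ⟨by norm_num, le_rfl⟩ (mem_Ici.2 hc0.le)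
    (mem_Ici.2 hη.1.le) hc
  rw [(classicalEq_iff η).1 hη.2.1, caputoFun_half] at h
  linarith

namespace IsClassicalSolution

variable {T η : ℝ} {u : ℝ → ℝ → ℝ} {s : ℝ → ℝ}

theorem front_le (h : IsClassicalSolution T u s) (hη : IsUniquePosRoot ClassicalEq η) {t : ℝ}
    (ht : t ∈ Icc 0 T) : s t ≤ classicalFront η t := by
  have hlim : Tendsto (fun δ => classicalFront (η + δ) (t + δ)) (𝓝[>] 0)
      (𝓝 (classicalFront (η + 0) (t + 0))) := by
    refine Tendsto.mono_left (Continuous.tendsto ?_ 0) nhdsWithin_le_nhds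
    unfold classicalFront; fun_prop
  rw [add_zero, add_zero] at hlim
  refine ge_of_tendsto hlim ?_
  filter_upwards [self_mem_nhdsWithin] with δ hδ
  have hδ' : 0 < δ := hδ
  have hK := lt_mul_erf hη (lt_add_of_pos_right η hδ')
  have hE : 0 < Real.exp (-(η + δ) ^ 2) / Real.sqrt Real.pi := by
    have := Real.sqrt_pos.2 Real.pi_pos
    positivity
  obtain ⟨lam, h1, h2⟩ := exists_between ((one_lt_div hE).2 hK)
  exact (h.front_lt_of_supersolution (add_pos hη.1 hδ') hδ' h1 ((lt_div_iff₀ hE).1 h2) t ht).le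

theorem le_front (h : IsClassicalSolution T u s) (hη : IsUniquePosRoot ClassicalEq η) {t : ℝ}
    (ht : t ∈ Ioc 0 T) : classicalFront η t ≤ s t := by
  have hlim : Tendsto (fun δ => classicalFront (η - δ) (t - δ)) (𝓝[>] 0)
      (𝓝 (classicalFront (η - 0) (t - 0))) := by
    refine Tendsto.mono_left (Continuous.tendsto ?_ 0) nhdsWithin_le_nhds
    unfold classicalFront; fun_prop
  rw [sub_zero, sub_zero] at hlim
  refine le_of_tendsto hlim ?_
  filter_upwards [Ioo_mem_nhdsGT (lt_min hη.1 ht.1)] with δ hδ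
  have hδη : δ < η := hδ.2.trans_le (min_le_left _ _)
  have hδt : δ < t := hδ.2.trans_le (min_le_right _ _)
  have hK := mul_erf_lt hη (sub_pos.2 hδη) (sub_lt_self η hδ.1)
  have hE : 0 < Real.exp (-(η - δ) ^ 2) / Real.sqrt Real.pi := by
    have := Real.sqrt_pos.2 Real.pi_pos
    positivity
  obtain ⟨lam, h1, h2⟩ := exists_between ((div_lt_one hE).2 hK)
  have hlam0 : 0 ≤ lam := le_trans
    (div_nonneg (mul_pos (sub_pos.2 hδη) (erf_pos (sub_pos.2 hδη))).le hE.le) h1.le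
  have := h.lt_front_of_subsolution (sub_pos.2 hδη) hδ.1 (hδt.trans_le ht.2) hlam0 h2
    ((div_lt_iff₀ hE).1 h1) (t - δ) ⟨by linarith, by linarith [ht.2]⟩
  rw [sub_add_cancel] at this
  exact this.le

theorem front_eq (h : IsClassicalSolution T u s) (hη : IsUniquePosRoot ClassicalEq η) {t : ℝ}
    (ht : t ∈ Icc 0 T) : s t = classicalFront η t := by
  rcases ht.1.eq_or_lt with rfl | h0
  · rw [h.front_zero, classicalFront_zero]
  · exact le_antisymm (h.front_le hη ht) (h.le_front hη ⟨h0, ht.2⟩)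

theorem temp_le_of_front_eq {v : ℝ → ℝ → ℝ} {r : ℝ → ℝ} (h : IsClassicalSolution T u s)
    (h' : IsClassicalSolution T v r) (hsr : ∀ t ∈ Icc 0 T, s t = r t) :
    ∀ t ∈ Ioc 0 T, ∀ x ∈ Icc 0 (s t), u x t ≤ v x t := by
  obtain ⟨C, hC⟩ := h.temp_bounded
  have hsr' : ∀ t ∈ Ioc 0 T, s t = r t := fun t ht => hsr t ⟨ht.1.le, ht.2⟩
  have := caloric_le_of_lateral_boundary (v := fun x t => u x t - v x t) h.front_continuous
    h.front_zero h.front_pos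
    (h.temp_continuous.sub (h'.temp_continuous.mono fun p hp => ⟨hp.1, hsr' _ hp.1 ▸ hp.2⟩))
    ⟨C, fun t ht x hx => by
      linarith [(abs_le.1 (hC t ht x hx)).2, h'.temp_nonneg t ht x (hsr' t ht ▸ hx)]⟩
    (fun t ht x hx => (h.isCaloricAt ht hx).sub
      (h'.isCaloricAt ht (hsr' t ⟨ht.1, ht.2.le⟩ ▸ hx)))
    (fun t ht => by rw [h.fixed_face t ht, h'.fixed_face t ht, sub_self])
    (fun t ht => by rw [h.front_temp t ht, hsr' t ht, h'.front_temp t ht, sub_self])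
  exact fun t ht x hx => sub_nonpos.1 (this t ht x hx)

theorem temp_eq_of_front_eq {v : ℝ → ℝ → ℝ} {r : ℝ → ℝ} (h : IsClassicalSolution T u s)
    (h' : IsClassicalSolution T v r) (hsr : ∀ t ∈ Icc 0 T, s t = r t) {t x : ℝ} (ht : t ∈ Ioc 0 T)
    (hx : x ∈ Icc 0 (s t)) : u x t = v x t :=
  le_antisymm (h.temp_le_of_front_eq h' hsr t ht x hx)
    (h'.temp_le_of_front_eq h (fun τ hτ => (hsr τ hτ).symm) t ht x
      (hsr t ⟨ht.1.le, ht.2⟩ ▸ hx))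

end IsClassicalSolution

end Stefan

theorem theorem2 :
    ∃ (η₁ : ℝ) (η ξ : ℝ → ℝ),
      -- the parameters are the unique positive roots of the respective equations
      Stefan.IsUniquePosRoot Stefan.ClassicalEq η₁ ∧
      (∀ α ∈ Ioo (0 : ℝ) 1, Stefan.IsUniquePosRoot (Stefan.CaputoEq α) (η α)) ∧
      (∀ α ∈ Ioo (0 : ℝ) 1, Stefan.IsUniquePosRoot (Stefan.RiemannLiouvilleEq α) (ξ α)) ∧
      -- the limit is the unique classical solution of the Stefan problem
      (∀ T : ℝ, 0 < T →
        Stefan.IsClassicalSolution T (Stefan.classicalTemp η₁) (Stefan.classicalFront η₁) ∧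
        ∀ (u : ℝ → ℝ → ℝ) (s : ℝ → ℝ), Stefan.IsClassicalSolution T u s →
          (∀ t ∈ Icc 0 T, s t = Stefan.classicalFront η₁ t) ∧
          (∀ t ∈ Ioc 0 T, ∀ x ∈ Icc 0 (s t), u x t = Stefan.classicalTemp η₁ x t)) ∧
      -- convergence of the parameters
      Tendsto η (𝓝[<] 1) (𝓝 η₁) ∧
      Tendsto ξ (𝓝[<] 1) (𝓝 η₁) ∧
      -- convergence of the explicit solutions in the Caputo case
      (∀ x t : ℝ, 0 ≤ x → 0 < t →
        Tendsto (fun α => Stefan.fracTemp α (η α) x t) (𝓝[<] 1)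
          (𝓝 (Stefan.classicalTemp η₁ x t))) ∧
      (∀ t : ℝ, 0 ≤ t →
        Tendsto (fun α => Stefan.fracFront α (η α) t) (𝓝[<] 1)
          (𝓝 (Stefan.classicalFront η₁ t))) ∧
      -- convergence of the explicit solutions in the Riemann–Liouville case
      (∀ x t : ℝ, 0 ≤ x → 0 < t →
        Tendsto (fun α => Stefan.fracTemp α (ξ α) x t) (𝓝[<] 1)
          (𝓝 (Stefan.classicalTemp η₁ x t))) ∧
      (∀ t : ℝ, 0 ≤ t →
        Tendsto (fun α => Stefan.fracFront α (ξ α) t) (𝓝[<] 1)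
          (𝓝 (Stefan.classicalFront η₁ t))) := by
  have hhalf : (1 / 2 : ℝ) ∈ Ioc (0 : ℝ) (1 / 2) := ⟨by norm_num, le_rfl⟩
  have hIoc : ∀ {α : ℝ}, α ∈ Ioo (0 : ℝ) 1 → α / 2 ∈ Ioc (0 : ℝ) (1 / 2) :=
    fun {α} hα => ⟨by linarith [hα.1], by linarith [hα.2]⟩
  obtain ⟨η₁, h₁⟩ := Stefan.exists_isUniquePosRoot_caputoFun hhalf
  have hη : ∀ α : ℝ, ∃ c, α ∈ Ioo (0 : ℝ) 1 →
      Stefan.IsUniquePosRoot (fun x => Stefan.caputoFun (α / 2) x = 0) c := fun α => by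
    by_cases hα : α ∈ Ioo (0 : ℝ) 1
    · exact (Stefan.exists_isUniquePosRoot_caputoFun (hIoc hα)).imp fun c hc _ => hc
    · exact ⟨0, fun h => absurd h hα⟩
  have hξ : ∀ α : ℝ, ∃ c, α ∈ Ioo (0 : ℝ) 1 →
      Stefan.IsUniquePosRoot (fun x => Stefan.riemannLiouvilleFun (α / 2) x = 0) c := fun α => by
    by_cases hα : α ∈ Ioo (0 : ℝ) 1
    · exact (Stefan.exists_isUniquePosRoot_riemannLiouvilleFun (hIoc hα)).imp fun c hc _ => hc
    · exact ⟨0, fun h => absurd h hα⟩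
  choose η hη using hη
  choose ξ hξ using hξ
  have hclass : Stefan.IsUniquePosRoot Stefan.ClassicalEq η₁ := by
    rwa [funext fun x => propext (Stefan.classicalEq_iff x)]
  have hev := Stefan.eventually_mem_Ioo_nhdsLT_one
  have hmono := Stefan.strictMonoOn_caputoFun hhalf
  have hηlim : Tendsto η (𝓝[<] 1) (𝓝 η₁) := Stefan.tendsto_of_isUniquePosRoot
    (hev.mono fun α hα => Stefan.strictMonoOn_caputoFun (hIoc hα)) hmono
    (fun x _ => Stefan.tendsto_caputoFun x) (hev.mono hη) h₁
  have hξlim : Tendsto ξ (𝓝[<] 1) (𝓝 η₁) := Stefan.tendsto_of_isUniquePosRoot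
    (hev.mono fun α hα => Stefan.strictMonoOn_riemannLiouvilleFun (hIoc hα))
    hmono (fun x _ => Stefan.tendsto_riemannLiouvilleFun x) (hev.mono hξ) h₁
  refine ⟨η₁, η, ξ, hclass, fun α hα => ?_, fun α hα => ?_, fun T hT => ?_, hηlim, hξlim,
    fun x t _ ht => Stefan.tendsto_fracTemp h₁.1 hηlim x ht,
    fun t ht => Stefan.tendsto_fracFront hηlim ht,
    fun x t _ ht => Stefan.tendsto_fracTemp h₁.1 hξlim x ht,
    fun t ht => Stefan.tendsto_fracFront hξlim ht⟩
  · rw [funext fun x => propext (Stefan.caputoEq_iff α x)]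
    exact hη α hα
  · rw [funext fun x => propext (Stefan.riemannLiouvilleEq_iff α x)]
    exact hξ α hα
  · have hsol := Stefan.isClassicalSolution_classicalTemp h₁.1 hclass.2.1 T
    exact ⟨hsol, fun u s h => ⟨fun t ht => h.front_eq hclass ht, fun t ht x hx =>
      h.temp_eq_of_front_eq hsol (fun τ hτ => h.front_eq hclass hτ) ht hx⟩⟩
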